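/- Let $I=[a,b]\subset\mathbb R$, $a<b$. A continuous map $f\colon I\to I$ is piecewise monotone if $I$ can be subdivided into finitely many closed intervals on each of which $f$ is strictly monotone; its set $\mathrm{Trn}(f)$ of turning points consists of the local extrema of $f$ in the interior of $I$. For real $x,y$ let $\langle x,y\rangle$ be the convex hull of $\{x,y\}$. A piecewise monotone map $f$ is virtually unimodal with dominant turning point $c\in\mathrm{Trn}(f)$ if (VU1) $\mathrm{Trn}(f)\cap\mathrm{int}\,\langle f^2(c),f(c)\rangle=\{c\}$; (VU2) $f^n(c)\in\langle f^2(c),f(c)\rangle$ for all $n\ge 0$; (VU3) there is $k\ge 0$ with $f^k(\mathrm{Trn}(f))\subset\langle f^2(c),f(c)\rangle$. A periodic point $x$ of $f$ of minimal period $n$ is repelling if there is an open set $U\ni x$ of $I$ such that for every $y\in U\setminus\{x\}$ there is $k\in\mathbb N$ with $f^{nk}(y)\notin U$. A point $y\in I$ is asymptotic to the orbit of $x$ if $\lim_{k\to\infty}f^{kn+m}(y)=x$ for some $m\in\mathbb N$. The Artin–Mazur zeta function of $f$ is the formal power series \[\zeta_f(t)=\exp\Big(\sum_{n\ge1}\frac{N_n(f)}{n}t^n\Big)\in\mathbb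 Q[[t]],\] where $N_n(f)$ is the number of isolated fixed points of $f^n$; it is called rational if it is the power series expansion of an element of $\mathbb Q(t)$. Theorem. Let $f\colon I\to I$ be virtually unimodal with dominant turning point $c$, and suppose that all but finitely many of the periodic points of $f$ are repelling. Then $\zeta_f$ is rational if and only if $c$ is asymptotic to a periodic orbit of $f$. -/

import Mathlib

open Filter Topology Function

namespace IntervalDynamics

variable {a b : ℝ}

/-- A continuous self-map of `[a, b]` is piecewise monotone if `[a, b]` has a finite subdivision
`a = p 0 < p 1 < ⋯ < p (m + 1) = b` such that the map is strictly monotone on each closed piece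
(merging adjacent pieces makes the pieces maximal). -/
structure IsPiecewiseMonotone (f : Set.Icc a b → Set.Icc a b) : Prop where
  continuous : Continuous f
  exists_subdivision : ∃ (m : ℕ) (p : Fin (m + 2) → Set.Icc a b),
    StrictMono p ∧ (p 0 : ℝ) = a ∧ (p (Fin.last (m + 1)) : ℝ) = b ∧
    ∀ i : Fin (m + 1),
      StrictMonoOn f (Set.Icc (p i.castSucc) (p i.succ)) ∨
      StrictAntiOn f (Set.Icc (p i.castSucc) (p i.succ))

/-- The turning points: the local extrema lying in the interior of `[a, b]`. -/
def turningPoints (f : Set.Icc a b → Set.Icc a b) : Set (Set.Icc a b) :=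
  {x | a < (x : ℝ) ∧ (x : ℝ) < b ∧ IsLocalExtr f x}

/-- `f` is virtually unimodal with dominant turning point `c`. Here
`Set.uIcc (f (f c)) (f c)` is the convex hull of `{f (f c), f c}`. -/
structure IsVirtuallyUnimodal (f : Set.Icc a b → Set.Icc a b) (c : Set.Icc a b) : Prop where
  piecewiseMonotone : IsPiecewiseMonotone f
  mem_turningPoints : c ∈ turningPoints f
  turningPoints_inter :
    (Subtype.val '' turningPoints f) ∩ interior (Set.uIcc (f (f c) : ℝ) (f c : ℝ)) = {(c : ℝ)}
  orbit_subset : ∀ n : ℕ, f^[n] c ∈ Set.uIcc (f (f c)) (f c)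
  turningPoints_image : ∃ k : ℕ, f^[k] '' turningPoints f ⊆ Set.uIcc (f (f c)) (f c)

/-- The periodic point `x`, of minimal period `n`, is repelling: some open set `U ∋ x` is left
by every other point of `U` under iteration of `f^n`. -/
def IsRepellingPeriodicPt {X : Type*} [TopologicalSpace X] (f : X → X) (x : X) : Prop :=
  x ∈ periodicPts f ∧ ∃ U : Set X, IsOpen U ∧ x ∈ U ∧
    ∀ y ∈ U, y ≠ x → ∃ k : ℕ, f^[minimalPeriod f x * k] y ∉ U

/-- `y` is asymptotic to a periodic orbit of `f`: there are a periodic point `x`, of minimal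
period `n`, and an `m` with `f^(k n + m) y → x` as `k → ∞`. -/
def IsAsymptoticToPeriodicOrbit {X : Type*} [TopologicalSpace X] (f : X → X) (y : X) : Prop :=
  ∃ x ∈ periodicPts f, ∃ m : ℕ,
    Tendsto (fun k : ℕ => f^[k * minimalPeriod f x + m] y) atTop (𝓝 x)

/-- The isolated fixed points of `f^n`. -/
def isolatedFixedPts {X : Type*} [TopologicalSpace X] (f : X → X) (n : ℕ) : Set X :=
  {x | f^[n] x = x ∧ ∃ U : Set X, IsOpen U ∧ x ∈ U ∧ ∀ y ∈ U, f^[n] y = y → y = x}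

/-- The Artin–Mazur zeta function `exp (∑_{n ≥ 1} N_n(f) t^n / n)`, a formal power series, where
`N_n(f)` is the number of isolated fixed points of `f^n`. -/
noncomputable def artinMazurZeta {X : Type*} [TopologicalSpace X] (f : X → X) : PowerSeries ℚ :=
  (PowerSeries.exp ℚ).subst
    (PowerSeries.mk fun n : ℕ => if n = 0 then 0 else ((isolatedFixedPts f n).ncard : ℚ) / n)

/-- A formal power series is (the expansion of) a rational function. -/
def IsRationalSeries (F : PowerSeries ℚ) : Prop :=
  ∃ p q : Polynomial ℚ, q ≠ 0 ∧ F * (q : PowerSeries ℚ) = (p : PowerSeries ℚ)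

end IntervalDynamics

/-!
The zeta function is computed by the kneading theory of Milnor and Thurston. Split every point into
its two one-sided germs, on which `f` acts with a slope `±1`. Half the product of the slope of `f^n`
and the sign of its displacement is a function of germs which is constant over the gaps between the
fixed points of `f^n` and the ends of its laps. Its jump is `1` at a fixed point, minus the number
of attracting germs there, and is read off from the signed itinerary at the end of a lap; so the sum
of all jumps counts the fixed points. As all but finitely many periodic points repel, and those
meeting the turning points or the ends of the interval are finite in number, both corrections
are accounted for by a rational factor `F` (Bowen–Lanford). Summing over `n`, the contribution of
the laps is the logarithmic derivative of the determinant of the kneading matrix `K`, and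
`ζ_f · det K · F = 1 - σ X`, where `σ` is the average of the slopes at the two ends.

For a virtually unimodal map all turning points are eventually mapped into `[p, q] = ⟨f²(c), f(c)⟩`,
which is invariant and contains no turning point but `c`. Itineraries with respect to the other
turning points are then constant up to finitely many terms, and after column operations `det K` is
a rational multiple of the generating function of the slopes of `f^(n + 1)` at `c`. Its coefficients
are `±1`, so it is rational if and only if they are eventually periodic, of period `P` say. In that
case the points `f^(kP + M) c` move monotonically in `k` and converge to a point fixed by `f^P`;
conversely, an orbit asymptotic to a periodic orbit missing `c` eventually has the slopes of the
latter.
-/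

namespace IntervalDynamics

section EventuallyPeriodic

variable {α β : Type*} {e e' : ℕ → α}

/-- A sequence is eventually periodic if it agrees, from some index on, with its translate by some
positive period. -/
def EventuallyPeriodic (e : ℕ → α) : Prop :=
  ∃ M p : ℕ, 0 < p ∧ ∀ m, M ≤ m → e (m + p) = e m

theorem EventuallyPeriodic.comp (he : EventuallyPeriodic e) (φ : α → β) :
    EventuallyPeriodic fun m => φ (e m) := by
  obtain ⟨M, p, hp, h⟩ := he
  exact ⟨M, p, hp, fun m hm => congrArg φ (h m hm)⟩

theorem EventuallyPeriodic.congr (he : EventuallyPeriodic e) (h : e' =ᶠ[atTop] e) :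
    EventuallyPeriodic e' := by
  obtain ⟨M, p, hp, he⟩ := he
  obtain ⟨k, hk⟩ := eventually_atTop.1 h
  refine ⟨max M k, p, hp, fun m hm => ?_⟩
  rw [hk m (by omega), hk (m + p) (by omega), he m (by omega)]

theorem eventuallyPeriodic_of_window {S : Set α} (hS : S.Finite) (M d : ℕ)
    (he : ∀ n, M ≤ n → e n ∈ S)
    (hdet : ∀ m n, M ≤ m → M ≤ n → (∀ i ≤ d, e (m + i) = e (n + i)) →
      e (m + d + 1) = e (n + d + 1)) :
    EventuallyPeriodic e := by
  obtain ⟨m, hm, n, hn, hmn, hw⟩ := (Set.Ici_infinite M).exists_lt_map_eq_of_mapsTo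
    (f := fun (n : ℕ) (i : Fin (d + 1)) => e (n + i)) (t := {v | ∀ i, v i ∈ S})
    (fun n hn i => he _ (le_add_right hn)) (Set.Finite.pi' fun _ => hS)
  have hM : M ≤ m ∧ M ≤ n := ⟨hm, hn⟩
  have window : ∀ k, ∀ i ≤ d, e (m + k + i) = e (n + k + i) := by
    intro k
    induction k with
    | zero => exact fun i hi => congrFun hw ⟨i, by omega⟩
    | succ k ih =>
      intro i hi
      rcases hi.lt_or_eq with hi | rfl
      · rw [show m + (k + 1) + i = m + k + (i + 1) by omega, ih (i + 1) hi]
        congr 1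
        omega
      · rw [show m + (k + 1) + i = m + k + i + 1 by omega,
          hdet (m + k) (n + k) (by omega) (by omega) ih]
        congr 1
        omega
  refine ⟨m, n - m, by omega, fun k hk => ?_⟩
  have := window (k - m) 0 (Nat.zero_le d)
  rw [show k + (n - m) = n + (k - m) + 0 by omega, ← this]
  congr 1
  omega

theorem eventuallyPeriodic_iterate {g : α → α} {x : α} {S : Set α} (hS : S.Finite)
    (h : ∀ᶠ m in atTop, g^[m] x ∈ S) : EventuallyPeriodic fun m => g^[m] x := by
  obtain ⟨M, hM⟩ := eventually_atTop.1 h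
  refine eventuallyPeriodic_of_window hS M 0 hM fun m n _ _ hw => ?_
  have : g^[m] x = g^[n] x := hw 0 le_rfl
  simp only [add_zero, iterate_succ_apply', this]

end EventuallyPeriodic

section RationalSeries

open PowerSeries

theorem isRationalSeries_coe (p : Polynomial ℚ) : IsRationalSeries (p : ℚ⟦X⟧) :=
  ⟨p, 1, one_ne_zero, by simp⟩

/-- The rational power series, as a subring of the ring of formal power series. -/
def rationalSeries : Subring ℚ⟦X⟧ where
  carrier := {F | IsRationalSeries F}
  mul_mem' := by
    rintro F G ⟨p, q, hq, hF⟩ ⟨p', q', hq', hG⟩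
    refine ⟨p * p', q * q', mul_ne_zero hq hq', ?_⟩
    push_cast
    rw [← hF, ← hG]
    ring
  add_mem' := by
    rintro F G ⟨p, q, hq, hF⟩ ⟨p', q', hq', hG⟩
    refine ⟨p * q' + p' * q, q * q', mul_ne_zero hq hq', ?_⟩
    push_cast
    rw [← hF, ← hG]
    ring
  one_mem' := by simpa using isRationalSeries_coe 1
  zero_mem' := by simpa using isRationalSeries_coe 0
  neg_mem' := by
    rintro F ⟨p, q, hq, hF⟩
    exact ⟨-p, q, hq, by push_cast; rw [← hF, neg_mul]⟩

theorem mem_rationalSeries {F : ℚ⟦X⟧} : F ∈ rationalSeries ↔ IsRationalSeries F := Iff.rfl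

theorem X_mem_rationalSeries : (X : ℚ⟦X⟧) ∈ rationalSeries := by
  simpa [mem_rationalSeries] using isRationalSeries_coe Polynomial.X

theorem C_mem_rationalSeries (r : ℚ) : (C r : ℚ⟦X⟧) ∈ rationalSeries := by
  simpa [mem_rationalSeries] using isRationalSeries_coe (Polynomial.C r)

theorem IsRationalSeries.of_mul_right {F G : ℚ⟦X⟧} (hG : IsRationalSeries G) (hG₀ : G ≠ 0)
    (hFG : IsRationalSeries (F * G)) : IsRationalSeries F := by
  obtain ⟨p, q, hq, hG⟩ := hG
  obtain ⟨p', q', hq', hFG⟩ := hFG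
  have hp : p ≠ 0 := by
    rintro rfl
    have hqG : G * (q : ℚ⟦X⟧) ≠ 0 := mul_ne_zero hG₀ (by exact_mod_cast hq)
    exact hqG (by rw [hG, Polynomial.coe_zero])
  refine ⟨p' * q, p * q', mul_ne_zero hp hq', ?_⟩
  push_cast
  rw [← hG, ← hFG]
  ring

theorem isRationalSeries_iff_of_mul_eq {F G H : ℚ⟦X⟧} (hH : IsRationalSeries H) (hH₀ : H ≠ 0)
    (h : F * G = H) : IsRationalSeries F ↔ IsRationalSeries G := by
  subst h
  exact ⟨fun hF => hF.of_mul_right (left_ne_zero_of_mul hH₀) (by rwa [mul_comm]),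
    fun hG => hG.of_mul_right (right_ne_zero_of_mul hH₀) hH⟩

theorem isRationalSeries_of_coeff_eq_zero {F : ℚ⟦X⟧} (M : ℕ)
    (h : ∀ m, M ≤ m → coeff m F = 0) : IsRationalSeries F := by
  have hF : F = ((trunc M F : Polynomial ℚ) : ℚ⟦X⟧) := by
    ext n
    rw [Polynomial.coeff_coe, coeff_trunc]
    split_ifs with hn
    · rfl
    · exact h n (not_lt.1 hn)
  rw [hF]
  exact isRationalSeries_coe _

theorem EventuallyPeriodic.isRationalSeries {e : ℕ → ℚ} (he : EventuallyPeriodic e) :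
    IsRationalSeries (mk e) := by
  obtain ⟨M, p, hp, h⟩ := he
  have hrat : (1 - X ^ p : ℚ⟦X⟧) ∈ rationalSeries :=
    sub_mem (one_mem _) (pow_mem X_mem_rationalSeries p)
  refine IsRationalSeries.of_mul_right hrat (fun h₀ => ?_)
    (isRationalSeries_of_coeff_eq_zero (M + p) fun m hm => ?_)
  · simpa [hp.ne'] using congrArg (coeff 0) h₀
  · have := h (m - p) (by omega)
    rw [Nat.sub_add_cancel (by omega)] at this
    rw [mul_sub, mul_one, map_sub, coeff_mk, coeff_mul_X_pow', if_pos (by omega), coeff_mk, this,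
      sub_self]

theorem IsRationalSeries.exists_coeff_zero_ne_zero {F : ℚ⟦X⟧} (hF : IsRationalSeries F) :
    ∃ p q : Polynomial ℚ, q.coeff 0 ≠ 0 ∧ F * (q : ℚ⟦X⟧) = p := by
  obtain ⟨p, q, hq, h⟩ := hF
  obtain ⟨p', q', hp, hq', hunit⟩ := extract_gcd p q
  set g := gcd p q
  have hg : (g : ℚ⟦X⟧) ≠ 0 := by
    have : g ≠ 0 := left_ne_zero_of_mul (hq' ▸ hq)
    exact_mod_cast this
  have hred : F * (q' : ℚ⟦X⟧) = p' := by
    rw [hp, hq', Polynomial.coe_mul, Polynomial.coe_mul] at h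
    exact mul_left_cancel₀ hg (by linear_combination h)
  refine ⟨p', q', fun h₀ => ?_, hred⟩
  have hXq : Polynomial.X ∣ q' := Polynomial.X_dvd_iff.2 h₀
  have hXp : Polynomial.X ∣ p' := by
    rw [Polynomial.X_dvd_iff, ← Polynomial.coeff_coe, ← hred, coeff_mul,
      Finset.Nat.antidiagonal_zero, Finset.sum_singleton, Polynomial.coeff_coe, h₀, mul_zero]
  exact Polynomial.not_isUnit_X (isUnit_of_dvd_unit (dvd_gcd hXp hXq) hunit)

theorem IsRationalSeries.eventuallyPeriodic {e : ℕ → ℚ} (he : IsRationalSeries (mk e))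
    (hfin : (Set.range e).Finite) : EventuallyPeriodic e := by
  obtain ⟨p, q, hq, h⟩ := he.exists_coeff_zero_ne_zero
  set d := q.natDegree
  have recurrence : ∀ n, p.natDegree ≤ n → q.coeff 0 * e (n + d + 1) =
      -∑ i ∈ Finset.range d, q.coeff (i + 1) * e (n + (d - i)) := by
    intro n hn
    have hcoeff := congrArg (coeff (n + d + 1)) h
    rw [Polynomial.coeff_coe, Polynomial.coeff_eq_zero_of_natDegree_lt (by omega), mul_comm,
      coeff_mul, Finset.Nat.sum_antidiagonal_eq_sum_range_succ_mk,
      ← Finset.sum_subset (Finset.range_subset_range.2 (show d + 1 ≤ (n + d + 1).succ by omega)),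
      Finset.sum_range_succ'] at hcoeff
    · simp only [Polynomial.coeff_coe, coeff_mk, Nat.sub_zero] at hcoeff
      rw [eq_neg_iff_add_eq_zero, add_comm, ← hcoeff]
      congr 1
      refine Finset.sum_congr rfl fun i hi => ?_
      rw [show n + d + 1 - (i + 1) = n + (d - i) by grind]
    · intro i _ hi
      rw [Polynomial.coeff_coe, Polynomial.coeff_eq_zero_of_natDegree_lt (by grind), zero_mul]
  refine eventuallyPeriodic_of_window hfin p.natDegree d (fun n _ => Set.mem_range_self n)
    fun m n hm hn hw => mul_left_cancel₀ hq ?_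
  rw [recurrence m hm, recurrence n hn]
  exact congrArg _ (Finset.sum_congr rfl fun i _ => by rw [hw _ (Nat.sub_le d i)])

theorem det_mem_subring {A n : Type*} [CommRing A] [Fintype n] [DecidableEq n]
    (S : Subring A) (M : Matrix n n A) (h : ∀ i j, M i j ∈ S) : M.det ∈ S := by
  have hM : M = S.subtype.mapMatrix (Matrix.of fun i j => ⟨M i j, h i j⟩) := rfl
  rw [hM, ← RingHom.map_det]
  exact Subtype.property _

end RationalSeries

section JacobiFormula

variable {R A M ι : Type*} [CommRing R] [CommRing A] [Algebra R A]

theorem derivation_prod [AddCommGroup M] [Module A M] [Module R M] [DecidableEq ι]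
    (D : Derivation R A M) (s : Finset ι) (g : ι → A) :
    D (∏ i ∈ s, g i) = ∑ i ∈ s, (∏ j ∈ s.erase i, g j) • D (g i) := by
  induction s using Finset.induction_on with
  | empty => simp
  | insert a s ha ih =>
    rw [Finset.prod_insert ha, Derivation.leibniz, ih, Finset.sum_insert ha,
      Finset.erase_insert ha, add_comm, Finset.smul_sum]
    refine congrArg _ (Finset.sum_congr rfl fun i hi => ?_)
    have hia : a ≠ i := by
      rintro rfl
      exact ha hi
    rw [Finset.erase_insert_of_ne hia, Finset.prod_insert (by simp [ha]), mul_smul]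

variable [Fintype ι] [DecidableEq ι]

theorem derivation_det_eq_sum_updateCol (D : Derivation R A A) (M : Matrix ι ι A) :
    D M.det = ∑ i, (M.updateCol i fun k => D (M k i)).det := by
  simp only [Matrix.det_apply]
  rw [map_sum, Finset.sum_comm]
  refine Finset.sum_congr rfl fun σ _ => ?_
  rw [Units.smul_def, map_zsmul, derivation_prod, Finset.smul_sum]
  refine Finset.sum_congr rfl fun i _ => ?_
  rw [Units.smul_def, ← Finset.prod_erase_mul _ _ (Finset.mem_univ i), Matrix.updateCol_self,
    smul_eq_mul]
  congr 2
  exact Finset.prod_congr rfl fun j hj => (Matrix.updateCol_ne (Finset.ne_of_mem_erase hj)).symm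

theorem derivation_det (D : Derivation R A A) (M : Matrix ι ι A) :
    D M.det = (M.adjugate * M.map D).trace := by
  rw [derivation_det_eq_sum_updateCol, Matrix.trace]
  refine Finset.sum_congr rfl fun i _ => ?_
  rw [← Matrix.cramer_apply, Matrix.cramer_eq_adjugate_mulVec]
  rfl

end JacobiFormula

section LogDerivative

open PowerSeries

variable {R K ι : Type*} [CommRing R] [Field K]

/-- `D` is the logarithmic derivative `X F' / F` of the power series `F` with respect to the Euler
derivation `X d/dX`, an identity stated without division. -/
def HasLogDeriv (F D : R⟦X⟧) : Prop := X * d⁄dX R F = D * F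

theorem HasLogDeriv.mul {F G D D' : R⟦X⟧} (hF : HasLogDeriv F D) (hG : HasLogDeriv G D') :
    HasLogDeriv (F * G) (D + D') := by
  unfold HasLogDeriv at *
  rw [Derivation.leibniz, smul_eq_mul, smul_eq_mul]
  linear_combination F * hG + G * hF

theorem HasLogDeriv.unique [CharZero K] {F G D : K⟦X⟧} (hF : HasLogDeriv F D)
    (hG : HasLogDeriv G D) (h : constantCoeff F = constantCoeff G) (hG₀ : constantCoeff G ≠ 0) :
    F = G := by
  unfold HasLogDeriv at *
  have hwronskian : d⁄dX K F * G = F * d⁄dX K G := by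
    refine mul_left_cancel₀ (X_ne_zero (R := K)) ?_
    linear_combination G * hF - F * hG
  have hinv : G * G⁻¹ = 1 := PowerSeries.mul_inv_cancel G hG₀
  have hquot : F * G⁻¹ = 1 := by
    refine derivative.ext ?_ ?_
    · rw [Derivation.leibniz, derivative_inv', derivative_one, smul_eq_mul, smul_eq_mul]
      linear_combination G⁻¹ ^ 2 * hwronskian - G⁻¹ * d⁄dX K F * hinv
    · rw [map_mul, constantCoeff_inv, h, map_one, mul_inv_cancel₀ hG₀]
  linear_combination G * hquot - F * hinv

theorem hasLogDeriv_exp_subst [Algebra ℚ R] {g : R⟦X⟧} (hg : constantCoeff g = 0) :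
    HasLogDeriv ((PowerSeries.exp R).subst g) (X * d⁄dX R g) := by
  unfold HasLogDeriv
  rw [derivative_subst (HasSubst.of_constantCoeff_zero' hg), derivative_exp]
  ring

theorem constantCoeff_exp_subst [Algebra ℚ R] {g : R⟦X⟧} (hg : constantCoeff g = 0) :
    constantCoeff ((PowerSeries.exp R).subst g) = 1 := by
  have hsub := HasSubst.of_constantCoeff_zero' hg
  have h₀ := constantCoeff_subst_eq_zero hg (PowerSeries.exp R - 1) (by simp)
  rw [← sub_add_cancel (PowerSeries.exp R) 1, subst_add hsub, map_add,
    ← coe_substAlgHom hsub, map_one, coe_substAlgHom hsub, map_one]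
  exact add_eq_right.2 h₀

theorem X_mul_derivative_mk_div [CharZero K] (N : ℕ → K) :
    X * d⁄dX K (mk fun n : ℕ => if n = 0 then 0 else N n / n) = X * mk fun n => N (n + 1) := by
  congr 1
  ext n
  rw [coeff_derivative, coeff_mk, coeff_mk, if_neg n.succ_ne_zero]
  push_cast
  exact div_mul_cancel₀ _ n.cast_add_one_ne_zero

theorem hasLogDeriv_artinMazurZeta {Y : Type*} [TopologicalSpace Y] (f : Y → Y) :
    HasLogDeriv (artinMazurZeta f) (X * mk fun n => ((isolatedFixedPts f (n + 1)).ncard : ℚ)) := by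
  rw [← X_mul_derivative_mk_div fun n => ((isolatedFixedPts f n).ncard : ℚ)]
  exact hasLogDeriv_exp_subst (by simp [← coeff_zero_eq_constantCoeff_apply])

theorem constantCoeff_artinMazurZeta {Y : Type*} [TopologicalSpace Y] (f : Y → Y) :
    constantCoeff (artinMazurZeta f) = 1 :=
  constantCoeff_exp_subst (by simp [← coeff_zero_eq_constantCoeff_apply])

variable [Fintype ι] [DecidableEq ι]

theorem hasLogDeriv_det {K Q : Matrix ι ι R⟦X⟧} (h : K * Q = 1) :
    HasLogDeriv K.det (X * (Q * K.map (d⁄dX R)).trace) := by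
  have hadj : K.adjugate = K.det • Q := by
    calc K.adjugate = K.adjugate * (K * Q) := by rw [h, mul_one]
      _ = K.det • Q := by rw [← mul_assoc, Matrix.adjugate_mul, Matrix.smul_mul, one_mul]
  unfold HasLogDeriv
  rw [derivation_det, hadj, Matrix.smul_mul, Matrix.trace_smul, smul_eq_mul]
  ring

theorem one_sub_X_smul_mul_resolvent (A : Matrix ι ι R) :
    (1 - (X : R⟦X⟧) • A.map C) * Matrix.of (fun i j => mk fun n => (A ^ n) i j) = 1 := by
  ext i j n
  have hmul : (A.map C * Matrix.of fun i j => mk fun n => (A ^ n) i j) i j =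
      mk fun n => (A ^ (n + 1)) i j := by
    ext n
    simp [Matrix.mul_apply, pow_succ', coeff_C_mul]
  rw [sub_mul, one_mul, Matrix.smul_mul, Matrix.sub_apply, Matrix.smul_apply, hmul, smul_eq_mul,
    Matrix.of_apply]
  cases n with
  | zero => by_cases hij : i = j <;> simp [Matrix.one_apply, hij]
  | succ n => by_cases hij : i = j <;> simp [Matrix.one_apply, hij, coeff_succ_X_mul]

theorem hasLogDeriv_charpolyRev (A : Matrix ι ι R) :
    HasLogDeriv (A.charpolyRev : R⟦X⟧) (-(X * mk fun n => (A ^ (n + 1)).trace)) := by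
  have hdet : (A.charpolyRev : R⟦X⟧) = (1 - (X : R⟦X⟧) • A.map C).det := by
    rw [Matrix.charpolyRev, ← Polynomial.coeToPowerSeries.ringHom_apply, RingHom.map_det]
    congr 1
    ext1 i j
    by_cases hij : i = j <;> simp [hij, X_mul]
  have hder : (1 - (X : R⟦X⟧) • A.map C).map (d⁄dX R) = -A.map C := by
    ext1 i j
    by_cases hij : i = j <;> simp [hij]
  have htrace : (Matrix.of (fun i j => mk fun n => (A ^ n) i j) * A.map C).trace =
      mk fun n => (A ^ (n + 1)).trace := by
    ext n
    simp [Matrix.trace, Matrix.mul_apply, pow_succ, coeff_mul_C]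
  have := hasLogDeriv_det (one_sub_X_smul_mul_resolvent A)
  rwa [← hdet, hder, mul_neg, Matrix.trace_neg, htrace, mul_neg] at this

end LogDerivative

section FiniteDynamics

open PowerSeries

theorem one_submatrix_pow {ι R : Type*} [Fintype ι] [DecidableEq ι] [CommRing R] (g : ι → ι)
    (n : ℕ) : (Matrix.submatrix 1 g id : Matrix ι ι R) ^ n = Matrix.submatrix 1 g^[n] id := by
  induction n with
  | zero => simp
  | succ n ih =>
    rw [pow_succ', ih, iterate_succ]
    exact Matrix.one_submatrix_mul g (Equiv.refl ι) _

theorem trace_one_submatrix {ι R : Type*} [Fintype ι] [DecidableEq ι] [CommRing R] (g : ι → ι) :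
    (Matrix.submatrix 1 g id : Matrix ι ι R).trace = (fixedPoints g).ncard := by
  have hfix : fixedPoints g = {x ∈ (Finset.univ : Finset ι) | g x = x} := by
    ext x
    simp [IsFixedPt]
  rw [hfix, Set.ncard_coe_finset]
  simp [Matrix.trace, Matrix.one_apply, Finset.sum_boole]

theorem ncard_fixedPoints_restrict {α : Type*} {S : Set α} {h : α → α} (hS : Set.MapsTo h S S)
    (n : ℕ) : (fixedPoints (hS.restrict h S S)^[n]).ncard = (S ∩ fixedPoints h^[n]).ncard := by
  rw [← Set.ncard_image_of_injective _ Subtype.val_injective]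
  congr 1
  ext x
  simp [hS.iterate_restrict, fixedPoints, IsFixedPt, Subtype.ext_iff, and_comm]

/-- Bowen–Lanford: `det (1 - X A)`, for the transition matrix `A` of `h` on `S`, is the reciprocal
of the zeta function of `h` restricted to `S`. -/
theorem exists_isRationalSeries_hasLogDeriv_neg_ncard {α : Type*} {S : Set α} (hfin : S.Finite)
    {h : α → α} (hS : Set.MapsTo h S S) :
    ∃ F : ℚ⟦X⟧, IsRationalSeries F ∧ constantCoeff F = 1 ∧
      HasLogDeriv F (-(X * mk fun n => ((S ∩ fixedPoints h^[n + 1]).ncard : ℚ))) := by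
  classical
  have : Fintype S := hfin.fintype
  set A : Matrix S S ℚ := Matrix.submatrix 1 (hS.restrict h S S) id with hA
  have htrace (n : ℕ) : (A ^ (n + 1)).trace = ((S ∩ fixedPoints h^[n + 1]).ncard : ℚ) := by
    rw [hA, one_submatrix_pow, trace_one_submatrix, ncard_fixedPoints_restrict]
  refine ⟨A.charpolyRev, isRationalSeries_coe _, ?_, ?_⟩
  · rw [Polynomial.constantCoeff_coe, Polynomial.coeff_zero_eq_eval_zero, Matrix.eval_charpolyRev]
  · simpa only [htrace] using hasLogDeriv_charpolyRev A

end FiniteDynamics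

section Sides

variable {α β : Type*} [LinearOrder α] [LinearOrder β]

/-- A sign as a rational number. -/
def sgn : ℤˣ →* ℚ := (Int.castRingHom ℚ : ℤ →* ℚ).comp (Units.coeHom ℤ)

@[simp] theorem sgn_neg (s : ℤˣ) : sgn (-s) = -sgn s := by simp [sgn]

theorem sgn_mul_self (s : ℤˣ) : sgn s * sgn s = 1 := by
  rw [← map_mul, Int.units_mul_self, map_one]

theorem sgn_injective : Injective sgn := fun s t h => by simpa [sgn, Units.ext_iff] using h

/-- `y` lies strictly on the side `s` of `x`, where `1` stands for the right and `-1` for the left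
side. -/
def SideLT (s : ℤˣ) (x y : α) : Prop := (s = 1 ∧ x < y) ∨ (s = -1 ∧ y < x)

theorem sideLT_one {x y : α} : SideLT 1 x y ↔ x < y := by
  simp [SideLT, show (1 : ℤˣ) ≠ -1 by decide]

theorem sideLT_neg_one {x y : α} : SideLT (-1) x y ↔ y < x := by
  simp [SideLT, show (-1 : ℤˣ) ≠ 1 by decide]

theorem sideLT_neg {s : ℤˣ} {x y : α} : SideLT (-s) x y ↔ SideLT s y x := by
  rcases Int.units_eq_one_or s with rfl | rfl <;> simp [sideLT_one, sideLT_neg_one]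

theorem SideLT.not_symm {s : ℤˣ} {x y : α} (h : SideLT s x y) : ¬ SideLT s y x := by
  rcases h with ⟨rfl, h⟩ | ⟨rfl, h⟩
  exacts [fun h' => h.not_gt (sideLT_one.1 h'), fun h' => h.not_gt (sideLT_neg_one.1 h')]

theorem SideLT.ne {s : ℤˣ} {x y : α} (h : SideLT s x y) : x ≠ y := by
  rintro rfl
  exact h.not_symm h

theorem SideLT.trans {s : ℤˣ} {x y z : α} (h : SideLT s x y) (h' : SideLT s y z) :
    SideLT s x z := by
  rcases h with ⟨rfl, h⟩ | ⟨rfl, h⟩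
  exacts [sideLT_one.2 (h.trans (sideLT_one.1 h')),
    sideLT_neg_one.2 ((sideLT_neg_one.1 h').trans h)]

theorem SideLT.unique {s s' : ℤˣ} {x y : α} (h : SideLT s x y) (h' : SideLT s' x y) : s = s' := by
  rcases h with ⟨rfl, h⟩ | ⟨rfl, h⟩ <;> rcases h' with ⟨rfl, h'⟩ | ⟨rfl, h'⟩
  exacts [rfl, (h.not_gt h').elim, (h.not_gt h').elim, rfl]

theorem sideLT_or_sideLT (s : ℤˣ) {x y : α} (h : x ≠ y) : SideLT s x y ∨ SideLT s y x := by
  rcases Int.units_eq_one_or s with rfl | rfl <;> simp only [sideLT_one, sideLT_neg_one]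
  exacts [lt_or_gt_of_ne h, (lt_or_gt_of_ne h).symm]

theorem exists_sideLT_of_ne {x y : α} (h : x ≠ y) : ∃ s : ℤˣ, SideLT s x y :=
  (lt_or_gt_of_ne h).elim (fun h => ⟨1, sideLT_one.2 h⟩) fun h => ⟨-1, sideLT_neg_one.2 h⟩

theorem SideLT.mem_uIcc_iff {s : ℤˣ} {x y z : α} (h : SideLT s x y) :
    z ∈ Set.uIcc x y ↔ (z = x ∨ SideLT s x z) ∧ (z = y ∨ SideLT s z y) := by
  rcases h with ⟨rfl, h⟩ | ⟨rfl, h⟩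
  · simp only [Set.uIcc_of_le h.le, Set.mem_Icc, sideLT_one, le_iff_eq_or_lt, eq_comm]
  · simp only [Set.uIcc_of_ge h.le, Set.mem_Icc, sideLT_neg_one, le_iff_eq_or_lt, and_comm,
      eq_comm]

theorem SideLT.mem_uIoo_iff {s : ℤˣ} {x y z : α} (h : SideLT s x y) :
    z ∈ Set.uIoo x y ↔ SideLT s x z ∧ SideLT s z y := by
  rcases h with ⟨rfl, h⟩ | ⟨rfl, h⟩
  · simp only [Set.uIoo_of_le h.le, Set.mem_Ioo, sideLT_one]
  · simp only [Set.uIoo_of_ge h.le, Set.mem_Ioo, sideLT_neg_one, and_comm]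

theorem mem_uIcc_of_sideLT {s : ℤˣ} {x y z : α} (h : SideLT s x z) (h' : SideLT s z y) :
    z ∈ Set.uIcc x y :=
  (h.trans h').mem_uIcc_iff.2 ⟨Or.inr h, Or.inr h'⟩

theorem SideLT.exists_between [DenselyOrdered α] {s : ℤˣ} {x y z : α} (hy : SideLT s x y)
    (hz : SideLT s x z) : ∃ w, SideLT s x w ∧ SideLT s w y ∧ SideLT s w z := by
  rcases hy with ⟨rfl, hy⟩ | ⟨rfl, hy⟩
  · simp only [sideLT_one] at hz ⊢
    simpa only [lt_min_iff] using _root_.exists_between (lt_min hy hz)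
  · simp only [sideLT_neg_one] at hz ⊢
    obtain ⟨w, h, hw⟩ := _root_.exists_between (max_lt hy hz)
    exact ⟨w, hw, max_lt_iff.1 h⟩

/-- `g` is strictly monotone on `S` if `η = 1`, strictly antitone if `η = -1`. -/
def StrictSlopeOn (g : α → β) (η : ℤˣ) (S : Set α) : Prop :=
  ∀ u ∈ S, ∀ v ∈ S, u < v → SideLT η (g u) (g v)

theorem strictSlopeOn_of_strictMonoOn {g : α → β} {S : Set α} (h : StrictMonoOn g S) :
    StrictSlopeOn g 1 S :=
  fun _ hu _ hv huv => sideLT_one.2 (h hu hv huv)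

theorem strictSlopeOn_of_strictAntiOn {g : α → β} {S : Set α} (h : StrictAntiOn g S) :
    StrictSlopeOn g (-1) S :=
  fun _ hu _ hv huv => sideLT_neg_one.2 (h hu hv huv)

namespace StrictSlopeOn

variable {g : α → β} {η s : ℤˣ} {S S' : Set α} {x y : α}

theorem sideLT (h : StrictSlopeOn g η S) (hx : x ∈ S) (hy : y ∈ S) (hxy : SideLT s x y) :
    SideLT (s * η) (g x) (g y) := by
  rcases hxy with ⟨rfl, hxy⟩ | ⟨rfl, hxy⟩
  · simpa only [one_mul] using h x hx y hy hxy
  · simpa only [neg_one_mul, sideLT_neg] using h y hy x hx hxy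

theorem sideLT_ends (h : StrictSlopeOn g η (Set.uIcc x y)) (hxy : SideLT s x y) :
    SideLT (s * η) (g x) (g y) :=
  h.sideLT Set.left_mem_uIcc Set.right_mem_uIcc hxy

theorem mono (h : StrictSlopeOn g η S) (hS : S' ⊆ S) : StrictSlopeOn g η S' :=
  fun u hu v hv => h u (hS hu) v (hS hv)

theorem unique {η' : ℤˣ} (h : StrictSlopeOn g η S) (h' : StrictSlopeOn g η' S) (hx : x ∈ S)
    (hy : y ∈ S) (hxy : x ≠ y) : η = η' := by
  obtain ⟨s, hs⟩ := exists_sideLT_of_ne hxy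
  exact mul_left_cancel ((h.sideLT hx hy hs).unique (h'.sideLT hx hy hs))

theorem comp {δ : Type*} [LinearOrder δ] {k : β → δ} {θ : ℤˣ} {T : Set β}
    (hk : StrictSlopeOn k θ T) (h : StrictSlopeOn g η S) (hST : Set.MapsTo g S T) :
    StrictSlopeOn (k ∘ g) (η * θ) S :=
  fun u hu v hv huv => hk.sideLT (hST hu) (hST hv) (h u hu v hv huv)

theorem mapsTo_uIcc (h : StrictSlopeOn g η (Set.uIcc x y)) :
    Set.MapsTo g (Set.uIcc x y) (Set.uIcc (g x) (g y)) := by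
  rcases eq_or_ne x y with rfl | hxy
  · simp
  obtain ⟨s, hs⟩ := exists_sideLT_of_ne hxy
  intro z hz
  obtain ⟨hx, hy⟩ := hs.mem_uIcc_iff.1 hz
  exact (h.sideLT_ends hs).mem_uIcc_iff.2
    ⟨hx.imp (congrArg g) (h.sideLT Set.left_mem_uIcc hz),
      hy.imp (congrArg g) (h.sideLT hz Set.right_mem_uIcc)⟩

end StrictSlopeOn

end Sides

section Germs

variable {α β : Type*} [LinearOrder α] [LinearOrder β]

/-- A germ of a one-sided neighbourhood: a point together with one of its sides. -/
abbrev Germ (α : Type*) := α × ℤˣ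

/-- The germ is the germ of a nonempty one-sided neighbourhood: it is not the outer germ of an end
of the space. -/
def GermValid (γ : Germ α) : Prop := ∃ y, SideLT γ.2 γ.1 y

/-- The germ is the germ of a one-sided neighbourhood contained in the interval `J`. -/
def GermIn (J : Set α) (γ : Germ α) : Prop := γ.1 ∈ J ∧ ∃ y ∈ J, SideLT γ.2 γ.1 y

theorem GermIn.valid {J : Set α} {γ : Germ α} (h : GermIn J γ) : GermValid γ :=
  let ⟨y, _, hy⟩ := h.2
  ⟨y, hy⟩

theorem GermValid.bot_lt [OrderBot α] {x : α} (h : GermValid (x, -1)) : ⊥ < x :=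
  let ⟨_, hy⟩ := h
  bot_le.trans_lt (sideLT_neg_one.1 hy)

theorem GermValid.lt_top [OrderTop α] {x : α} (h : GermValid (x, 1)) : x < ⊤ :=
  let ⟨_, hy⟩ := h
  (sideLT_one.1 hy).trans_le le_top

theorem germIn_Icc_of_mem_Ioo {p q x : α} (h : x ∈ Set.Ioo p q) (s : ℤˣ) :
    GermIn (Set.Icc p q) (x, s) := by
  refine ⟨Set.Ioo_subset_Icc_self h, ?_⟩
  rcases Int.units_eq_one_or s with rfl | rfl
  exacts [⟨q, ⟨(h.1.trans h.2).le, le_rfl⟩, sideLT_one.2 h.2⟩,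
    ⟨p, ⟨le_rfl, (h.1.trans h.2).le⟩, sideLT_neg_one.2 h.1⟩]

theorem germValid_of_mem_Ioo {p q x : α} (h : x ∈ Set.Ioo p q) (s : ℤˣ) : GermValid (x, s) :=
  (germIn_Icc_of_mem_Ioo h s).valid

open Classical in
/-- The sign of monotonicity of `f` along a germ; it is `-1` by convention if `f` is not strictly
monotone along the germ. -/
noncomputable def slope (f : α → β) (γ : Germ α) : ℤˣ :=
  if ∃ y, SideLT γ.2 γ.1 y ∧ StrictSlopeOn f 1 (Set.uIcc γ.1 y) then 1 else -1

theorem StrictSlopeOn.slope_eq [DenselyOrdered α] {f : α → β} {η s : ℤˣ} {x y : α}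
    (h : StrictSlopeOn f η (Set.uIcc x y)) (hxy : SideLT s x y) : slope f (x, s) = η := by
  rcases Int.units_eq_one_or η with rfl | rfl
  · exact if_pos ⟨y, hxy, h⟩
  · refine if_neg ?_
    rintro ⟨z, hz, hmono⟩
    obtain ⟨w, hxw, hwy, hwz⟩ := hxy.exists_between hz
    have h₁ := h.sideLT Set.left_mem_uIcc (mem_uIcc_of_sideLT hxw hwy) hxw
    have h₂ := hmono.sideLT Set.left_mem_uIcc (mem_uIcc_of_sideLT hxw hwz) hxw
    exact absurd (mul_left_cancel (h₁.unique h₂)) (by decide)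

/-- The action of `f` on germs. -/
noncomputable def germMap (f : α → β) (γ : Germ α) : Germ β := (f γ.1, γ.2 * slope f γ)

/-- The sign of monotonicity of `f^n` along a germ. -/
noncomputable def slopeIter (f : α → α) (n : ℕ) (γ : Germ α) : ℤˣ :=
  ∏ i ∈ Finset.range n, slope f ((germMap f)^[i] γ)

@[simp] theorem slopeIter_zero (f : α → α) (γ : Germ α) : slopeIter f 0 γ = 1 := rfl

theorem slopeIter_add (f : α → α) (m n : ℕ) (γ : Germ α) :
    slopeIter f (m + n) γ = slopeIter f m γ * slopeIter f n ((germMap f)^[m] γ) := by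
  rw [slopeIter, Finset.prod_range_add]
  simp only [slopeIter, ← iterate_add_apply, add_comm]

theorem slopeIter_one (f : α → α) (γ : Germ α) : slopeIter f 1 γ = slope f γ := by
  simp [slopeIter]

theorem slopeIter_succ (f : α → α) (n : ℕ) (γ : Germ α) :
    slopeIter f (n + 1) γ = slope f γ * slopeIter f n (germMap f γ) := by
  rw [add_comm, slopeIter_add, slopeIter_one, iterate_one]

theorem slopeIter_succ' (f : α → α) (n : ℕ) (γ : Germ α) :
    slopeIter f (n + 1) γ = slopeIter f n γ * slope f ((germMap f)^[n] γ) := by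
  rw [slopeIter_add, slopeIter_one]

theorem germMap_iterate (f : α → α) (n : ℕ) (γ : Germ α) :
    (germMap f)^[n] γ = (f^[n] γ.1, γ.2 * slopeIter f n γ) := by
  induction n generalizing γ with
  | zero => simp
  | succ n ih =>
    rw [iterate_succ_apply, ih, slopeIter_succ, iterate_succ_apply, ← mul_assoc]
    rfl

open Classical in
/-- The position of a germ relative to a point: `1 / 2` on the right, `-1 / 2` on the left. -/
noncomputable def position (γ : Germ α) (w : α) : ℚ :=
  if w < γ.1 ∨ (w = γ.1 ∧ γ.2 = 1) then 1 / 2 else -1 / 2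

theorem position_of_sideLT {γ : Germ α} {w : α} {s : ℤˣ} (h : SideLT s w γ.1) :
    position γ w = sgn s / 2 := by
  rcases h with ⟨rfl, h⟩ | ⟨rfl, h⟩
  · simp [position, h]
  · simp [position, h.not_gt, h.ne']

theorem position_self (x : α) (s : ℤˣ) : position (x, s) x = sgn s / 2 := by
  rcases Int.units_eq_one_or s with rfl | rfl <;> simp [position]

end Germs

section Gaps

variable {α : Type*} [LinearOrder α]

theorem exists_gap_right {V : Set α} (hV : V.Finite) {x q : α} (h : x < q) :
    ∃ y, x < y ∧ y ≤ q ∧ ∀ w ∈ Set.Ioo x y, w ∉ V := by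
  obtain hempty | hne := (V ∩ Set.Ioo x q).eq_empty_or_nonempty
  · exact ⟨q, h, le_rfl, fun w hw hwV => Set.notMem_empty w (hempty ▸ ⟨hwV, hw⟩)⟩
  · obtain ⟨y, ⟨-, hxy, hyq⟩, hmin⟩ :=
      Set.exists_min_image _ id (hV.inter_of_left (Set.Ioo x q)) hne
    exact ⟨y, hxy, hyq.le, fun w hw hwV =>
      (hmin w ⟨hwV, hw.1, hw.2.trans hyq⟩).not_gt hw.2⟩

theorem exists_gap {V : Set α} (hV : V.Finite) {s : ℤˣ} {x q : α} (h : SideLT s x q) :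
    ∃ y ∈ Set.uIcc x q, SideLT s x y ∧ ∀ w ∈ Set.uIoo x y, w ∉ V := by
  rcases h with ⟨rfl, h⟩ | ⟨rfl, h⟩
  · obtain ⟨y, hxy, hyq, hgap⟩ := exists_gap_right hV h
    exact ⟨y, Set.mem_uIcc_of_le hxy.le hyq, sideLT_one.2 hxy, by rwa [Set.uIoo_of_lt hxy]⟩
  · obtain ⟨y, hyx, hqy, hgap⟩ := exists_gap_right (α := αᵒᵈ) (V := OrderDual.ofDual ⁻¹' V)
      (hV.preimage OrderDual.ofDual.injective.injOn) (x := OrderDual.toDual x)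
      (q := OrderDual.toDual q) h
    refine ⟨y.ofDual, Set.mem_uIcc_of_ge hqy hyx.le, sideLT_neg_one.2 hyx, fun w hw => ?_⟩
    rw [Set.uIoo_of_gt (show y.ofDual < x from hyx)] at hw
    exact hgap (OrderDual.toDual w) ⟨hw.2, hw.1⟩

theorem finite_of_forall_lt_inter_Icc_nonempty {V S : Set α} (hV : V.Finite)
    (h : ∀ x ∈ S, ∀ y ∈ S, x < y → (V ∩ Set.Icc x y).Nonempty) : S.Finite := by
  suffices (S \ V).Finite from (this.union hV).subset fun x hx =>
    (em (x ∈ V)).elim Or.inr fun hxV => Or.inl ⟨hx, hxV⟩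
  have hstrict : StrictMonoOn (fun x => {v ∈ V | v < x}) (S \ V) := by
    intro x hx y hy hxy
    obtain ⟨w, hwV, hw⟩ := h x hx.1 y hy.1 hxy
    have hwy : w < y := hw.2.lt_of_ne (by rintro rfl; exact hy.2 hwV)
    exact Set.ssubset_iff_exists.2 ⟨fun v hv => ⟨hv.1, hv.2.trans hxy⟩, w, ⟨hwV, hwy⟩,
      fun hwx => hwx.2.not_ge hw.1⟩
  refine Set.Finite.of_finite_image (hV.finite_subsets.subset ?_) hstrict.injOn
  rintro _ ⟨x, -, rfl⟩
  exact Set.sep_subset _ _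

end Gaps

section GapConst

variable {α : Type*} [LinearOrder α]

/-- A function of germs is constant over the gaps of `V`. -/
def GapConst {M : Type*} (ψ : Germ α → M) (V : Set α) : Prop :=
  ∀ x y, x < y → (∀ w ∈ Set.Ioo x y, w ∉ V) → ψ (x, 1) = ψ (y, -1)

theorem GapConst.of_insert {M : Type*} {ψ : Germ α → M} {V : Set α} {v : α}
    (h : GapConst ψ (insert v V)) (hv : ψ (v, 1) = ψ (v, -1)) : GapConst ψ V := by
  intro x y hxy hgap
  by_cases hvxy : v ∈ Set.Ioo x y
  · rw [h x v hvxy.1, ← hv, h v y hvxy.2]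
    · rintro w hw (rfl | hwV)
      exacts [hw.1.false, hgap w ⟨hvxy.1.trans hw.1, hw.2⟩ hwV]
    · rintro w hw (rfl | hwV)
      exacts [hw.2.false, hgap w ⟨hw.1, hw.2.trans hvxy.2⟩ hwV]
  · refine h x y hxy ?_
    rintro w hw (rfl | hwV)
    exacts [hvxy hw, hgap w hw hwV]

theorem gapConst_position {v : α} {V : Set α} (hv : v ∈ V) :
    GapConst (fun γ : Germ α => position γ v) V := by
  intro x y hxy hgap
  rcases lt_trichotomy v x with h | rfl | h
  · simp only [position_of_sideLT (γ := (x, 1)) (sideLT_one.2 h),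
      position_of_sideLT (γ := (y, -1)) (sideLT_one.2 (h.trans hxy))]
  · simp only [position_self, position_of_sideLT (γ := (y, -1)) (sideLT_one.2 hxy)]
  · rcases (not_lt.1 fun hvy => hgap v ⟨h, hvy⟩ hv).eq_or_lt with rfl | hyv
    · simp only [position_self, position_of_sideLT (γ := (x, 1)) (sideLT_neg_one.2 h)]
    · simp only [position_of_sideLT (γ := (x, 1)) (sideLT_neg_one.2 h),
        position_of_sideLT (γ := (y, -1)) (sideLT_neg_one.2 hyv)]

theorem GapConst.sub_mul {ψ φ : Germ α → ℚ} {V : Set α} (hψ : GapConst ψ V) (hφ : GapConst φ V)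
    (r : ℚ) : GapConst (fun γ => ψ γ - r * φ γ) V := fun x y hxy hgap => by
  simp only [hψ x y hxy hgap, hφ x y hxy hgap]

theorem position_right_sub_left (v : α) : position (v, 1) v - position (v, -1) v = 1 := by
  rw [position_self, position_self, sgn_neg, map_one]
  norm_num

theorem position_right_eq_left {v w : α} (h : v ≠ w) : position (v, 1) w = position (v, -1) w := by
  obtain ⟨s, hs⟩ := exists_sideLT_of_ne h.symm
  rw [position_of_sideLT (γ := (v, 1)) hs, position_of_sideLT (γ := (v, -1)) hs]

theorem position_eq_of_notMem_uIoo {s : ℤˣ} {u v i : α} (h : SideLT s u v)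
    (hi : i ∉ Set.uIoo u v) : position (u, s) i = position (v, -s) i := by
  have hgap := gapConst_position (Set.mem_singleton i)
  have hmem {w : α} (hw : w ∈ Set.uIoo u v) : w ∉ ({i} : Set α) := fun e => hi (e ▸ hw)
  rcases Int.units_eq_one_or s with rfl | rfl
  · rw [sideLT_one] at h
    exact hgap u v h fun w hw => hmem (Set.uIoo_of_le h.le ▸ hw)
  · rw [sideLT_neg_one] at h
    rw [neg_neg]
    exact (hgap v u h fun w hw => hmem (Set.uIoo_of_ge h.le ▸ hw)).symm

theorem GapConst.eq_ends [BoundedOrder α] {M : Type*} {ψ : Germ α → M} (h : GapConst ψ ∅)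
    {γ : Germ α} (hγ : GermValid γ) : ψ γ = ψ (⊥, 1) ∧ ψ γ = ψ (⊤, -1) := by
  have hconst : ∀ x y : α, x < y → ψ (x, 1) = ψ (y, -1) := fun x y hxy =>
    h x y hxy fun w _ => Set.notMem_empty w
  obtain ⟨x, s⟩ := γ
  rcases Int.units_eq_one_or s with rfl | rfl
  · exact ⟨(hconst x ⊤ hγ.lt_top).trans (hconst ⊥ ⊤ (bot_le.trans_lt hγ.lt_top)).symm,
      hconst x ⊤ hγ.lt_top⟩
  · exact ⟨(hconst ⊥ x hγ.bot_lt).symm,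
      (hconst ⊥ x hγ.bot_lt).symm.trans (hconst ⊥ ⊤ (hγ.bot_lt.trans_le le_top))⟩

theorem GapConst.eq_add_sum [BoundedOrder α] {V : Finset α} {ψ : Germ α → ℚ}
    (h : GapConst ψ V) (hV : ∀ w ∈ V, ⊥ < w ∧ w < ⊤) {γ : Germ α} (hγ : GermValid γ) :
    ψ γ = (ψ (⊥, 1) + ψ (⊤, -1)) / 2 + ∑ w ∈ V, (ψ (w, 1) - ψ (w, -1)) * position γ w := by
  induction V using Finset.induction_on generalizing ψ with
  | empty =>
    obtain ⟨hbot, htop⟩ := GapConst.eq_ends (by simpa using h) hγ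
    rw [← hbot, ← htop, Finset.sum_empty]
    ring
  | insert v V hv ih =>
    rw [Finset.coe_insert] at h
    have hvlt := hV v (Finset.mem_insert_self v V)
    -- Subtracting the position relative to `v`, weighted by the jump of `ψ` at `v`, removes this
    -- jump and changes no other jump.
    set φ : Germ α → ℚ := fun γ => ψ γ - (ψ (v, 1) - ψ (v, -1)) * position γ v with hφ
    have hgap : GapConst φ V := by
      refine (h.sub_mul (gapConst_position (Set.mem_insert v _)) _).of_insert ?_
      linear_combination (ψ (v, -1) - ψ (v, 1)) * position_right_sub_left v
    have hjump : ∀ w ∈ V, φ (w, 1) - φ (w, -1) = ψ (w, 1) - ψ (w, -1) := fun w hw => by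
      simp only [hφ, position_right_eq_left (ne_of_mem_of_not_mem hw hv)]
      ring
    have hφγ := ih hgap fun w hw => hV w (Finset.mem_insert_of_mem hw)
    rw [Finset.sum_congr rfl fun w hw => congrArg (· * position γ w) (hjump w hw)] at hφγ
    rw [Finset.sum_insert hv]
    simp only [hφ, position_of_sideLT (γ := (⊥, 1)) (sideLT_neg_one.2 hvlt.1),
      position_of_sideLT (γ := (⊤, -1)) (sideLT_one.2 hvlt.2), sgn_neg, map_one] at hφγ
    linear_combination hφγ

end GapConst

section Laps

variable {α : Type*} [ConditionallyCompleteLinearOrder α] [DenselyOrdered α] [TopologicalSpace α]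
  [OrderTopology α] {f : α → α}

/-- The points which are not an end of the space: both their germs are valid. -/
def innerPoints (α : Type*) [LinearOrder α] : Set α := {x | ∀ s, GermValid (x, s)}

theorem mem_innerPoints_of_mem_Ioo {α : Type*} [LinearOrder α] {p q x : α}
    (h : x ∈ Set.Ioo p q) : x ∈ innerPoints α :=
  germValid_of_mem_Ioo h

theorem innerPoints_eq_Ioo {α : Type*} [LinearOrder α] [BoundedOrder α] :
    innerPoints α = Set.Ioo ⊥ ⊤ :=
  Set.Subset.antisymm (fun _ h => ⟨(h (-1)).bot_lt, (h 1).lt_top⟩)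
    fun _ h => mem_innerPoints_of_mem_Ioo h

/-- The local extrema which are not an end of the space. -/
def turning {α : Type*} [LinearOrder α] [TopologicalSpace α] (f : α → α) : Set α :=
  {x ∈ innerPoints α | IsLocalExtr f x}

/-- The points whose orbit hits a turning point before time `n`. -/
def turningIter {α : Type*} [LinearOrder α] [TopologicalSpace α] (f : α → α) (n : ℕ) : Set α :=
  {x | ∃ j < n, f^[j] x ∈ turning f}

theorem injOn_uIcc_of_gap (hf : Continuous f) {x y : α} (h : ∀ w ∈ Set.uIoo x y, w ∉ turning f) :
    (Set.uIcc x y).InjOn f := by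
  have key : ∀ u ∈ Set.uIcc x y, ∀ v ∈ Set.uIcc x y, u < v → f u ≠ f v := by
    intro u hu v hv huv he
    obtain ⟨w, hw, hext⟩ := exists_isLocalExtr_Ioo huv hf.continuousOn he
    exact h w ⟨hu.1.trans_lt hw.1, hw.2.trans_le hv.2⟩ ⟨mem_innerPoints_of_mem_Ioo hw, hext⟩
  intro u hu v hv he
  by_contra hne
  rcases lt_or_gt_of_ne hne with hlt | hlt
  exacts [key u hu v hv hlt he, key v hv u hu hlt he.symm]

theorem exists_strictSlopeOn_of_gap (hf : Continuous f) {x y : α}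
    (h : ∀ w ∈ Set.uIoo x y, w ∉ turning f) : ∃ η, StrictSlopeOn f η (Set.uIcc x y) :=
  (hf.continuousOn.strictMonoOn_of_injOn_Icc' inf_le_sup (injOn_uIcc_of_gap hf h)).elim
    (fun h => ⟨1, strictSlopeOn_of_strictMonoOn h⟩)
    fun h => ⟨-1, strictSlopeOn_of_strictAntiOn h⟩

theorem strictSlopeOn_of_gap (hf : Continuous f) {s : ℤˣ} {x y : α} (hxy : SideLT s x y)
    (h : ∀ w ∈ Set.uIoo x y, w ∉ turning f) :
    StrictSlopeOn f (slope f (x, s)) (Set.uIcc x y) := by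
  obtain ⟨η, hη⟩ := exists_strictSlopeOn_of_gap hf h
  rwa [hη.slope_eq hxy]

theorem uIoo_subset_image_uIoo {g : α → α} (hg : Continuous g) (x y : α) :
    Set.uIoo (g x) (g y) ⊆ g '' Set.uIoo x y := by
  rcases le_total x y with h | h <;> rcases le_total (g x) (g y) with hg' | hg' <;>
    simp only [Set.uIoo_of_le, Set.uIoo_of_ge, h, hg']
  exacts [intermediate_value_Ioo h hg.continuousOn, intermediate_value_Ioo' h hg.continuousOn,
    intermediate_value_Ioo' h hg.continuousOn, intermediate_value_Ioo h hg.continuousOn]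

theorem strictSlopeOn_iterate_of_gap (hf : Continuous f) (n : ℕ) {s : ℤˣ} {x y : α}
    (hxy : SideLT s x y) (h : ∀ w ∈ Set.uIoo x y, w ∉ turningIter f n) :
    StrictSlopeOn f^[n] (slopeIter f n (x, s)) (Set.uIcc x y) := by
  induction n generalizing s x y with
  | zero => exact fun u _ v _ huv => sideLT_one.2 huv
  | succ n ih =>
    have hf₁ := strictSlopeOn_of_gap hf hxy fun w hw hw' => h w hw ⟨0, n.succ_pos, hw'⟩
    have hfn := ih (hf₁.sideLT_ends hxy) fun w hw => by
      obtain ⟨z, hz, rfl⟩ := uIoo_subset_image_uIoo hf x y hw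
      rintro ⟨j, hj, hzj⟩
      exact h z hz ⟨j + 1, Nat.succ_lt_succ hj, hzj⟩
    rw [slopeIter_succ, iterate_succ]
    exact hfn.comp hf₁ hf₁.mapsTo_uIcc

theorem slopeIter_eq_of_gap (hf : Continuous f) (n : ℕ) {x y : α} (hxy : x < y)
    (h : ∀ w ∈ Set.Ioo x y, w ∉ turningIter f n) :
    slopeIter f n (x, 1) = slopeIter f n (y, -1) := by
  rw [← Set.uIoo_of_lt hxy] at h
  refine (strictSlopeOn_iterate_of_gap hf n (sideLT_one.2 hxy) h).unique ?_
    Set.left_mem_uIcc Set.right_mem_uIcc hxy.ne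
  rw [Set.uIoo_comm] at h
  rw [Set.uIcc_comm]
  exact strictSlopeOn_iterate_of_gap hf n (sideLT_neg_one.2 hxy) h

theorem slope_neg_of_notMem_turning (hf : Continuous f) (hT : (turning f).Finite) {x : α}
    (hx : x ∈ innerPoints α) (hxT : x ∉ turning f) (s : ℤˣ) :
    slope f (x, -s) = slope f (x, s) := by
  obtain ⟨q, hq⟩ := hx s
  obtain ⟨p, hp⟩ := hx (-s)
  obtain ⟨y, -, hxy, hy⟩ := exists_gap hT hq
  obtain ⟨z, -, hxz, hz⟩ := exists_gap hT hp
  have hzx : SideLT s z x := sideLT_neg.1 hxz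
  obtain ⟨η, hη⟩ := exists_strictSlopeOn_of_gap hf (x := z) (y := y) fun w hw => by
    obtain ⟨hzw, hwy⟩ := (hzx.trans hxy).mem_uIoo_iff.1 hw
    rcases eq_or_ne w x with rfl | hwx
    · exact hxT
    · rcases sideLT_or_sideLT s hwx with hwx | hxw
      · exact hz w (hxz.mem_uIoo_iff.2 ⟨sideLT_neg.2 hwx, sideLT_neg.2 hzw⟩)
      · exact hy w (hxy.mem_uIoo_iff.2 ⟨hxw, hwy⟩)
  have hxzy := mem_uIcc_of_sideLT hzx hxy
  rw [(hη.mono (Set.uIcc_subset_uIcc hxzy Set.left_mem_uIcc)).slope_eq hxz,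
    (hη.mono (Set.uIcc_subset_uIcc hxzy Set.right_mem_uIcc)).slope_eq hxy]

theorem finite_preimage_singleton (hf : Continuous f) (hT : (turning f).Finite) (v : α) :
    (f ⁻¹' {v}).Finite := by
  refine finite_of_forall_lt_inter_Icc_nonempty hT fun x hx y hy hxy => ?_
  by_contra hne
  refine hxy.ne (injOn_uIcc_of_gap hf (fun w hw hwT => hne ⟨w, hwT, ?_⟩) Set.left_mem_uIcc
    Set.right_mem_uIcc (hx.trans hy.symm))
  rw [Set.uIoo_of_lt hxy] at hw
  exact Set.Ioo_subset_Icc_self hw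

theorem finite_preimage_iterate (hf : Continuous f) (hT : (turning f).Finite) {V : Set α}
    (hV : V.Finite) (n : ℕ) : (f^[n] ⁻¹' V).Finite := by
  induction n with
  | zero => simpa using hV
  | succ n ih =>
    rw [iterate_succ, Set.preimage_comp]
    exact ih.preimage' fun b _ => finite_preimage_singleton hf hT b

theorem finite_turningIter (hf : Continuous f) (hT : (turning f).Finite) (n : ℕ) :
    (turningIter f n).Finite := by
  have : turningIter f n = ⋃ j ∈ Set.Iio n, f^[j] ⁻¹' turning f := by
    ext x
    simp [turningIter]
  rw [this]
  exact (Set.finite_Iio n).biUnion fun j _ => finite_preimage_iterate hf hT hT j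

theorem exists_strictSlopeOn_iterate (hf : Continuous f) (hT : (turning f).Finite) (n : ℕ)
    {s : ℤˣ} {x q : α} (h : SideLT s x q) :
    ∃ y ∈ Set.uIcc x q, SideLT s x y ∧
      StrictSlopeOn f^[n] (slopeIter f n (x, s)) (Set.uIcc x y) := by
  obtain ⟨y, hy, hxy, hgap⟩ := exists_gap (finite_turningIter hf hT n) h
  exact ⟨y, hy, hxy, strictSlopeOn_iterate_of_gap hf n hxy hgap⟩

theorem GermIn.germMap_iterate (hf : Continuous f) (hT : (turning f).Finite) {J : Set α}
    [J.OrdConnected] (hJ : Set.MapsTo f J J) {γ : Germ α} (hγ : GermIn J γ) (n : ℕ) :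
    GermIn J ((germMap f)^[n] γ) := by
  obtain ⟨hγJ, q, hq, hγq⟩ := hγ
  obtain ⟨y, hy, hγy, hslope⟩ := exists_strictSlopeOn_iterate hf hT n hγq
  rw [IntervalDynamics.germMap_iterate]
  exact ⟨hJ.iterate n hγJ, f^[n] y, hJ.iterate n (Set.OrdConnected.uIcc_subset ‹_› hγJ hq hy),
    hslope.sideLT_ends hγy⟩

theorem GermValid.germMap_iterate (hf : Continuous f) (hT : (turning f).Finite) {γ : Germ α}
    (hγ : GermValid γ) (n : ℕ) : GermValid ((germMap f)^[n] γ) :=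
  let ⟨y, hy⟩ := hγ
  (GermIn.germMap_iterate hf hT (Set.mapsTo_univ f Set.univ)
    ⟨Set.mem_univ γ.1, y, Set.mem_univ y, hy⟩ n).valid

end Laps

section SideNhds

variable {α : Type*} [LinearOrder α] [TopologicalSpace α]

/-- The filter of one-sided neighbourhoods given by a germ. -/
def sideNhds (γ : Germ α) : Filter α := 𝓝[{z | SideLT γ.2 γ.1 z}] γ.1

theorem sideNhds_le_nhds (γ : Germ α) : sideNhds γ ≤ 𝓝 γ.1 := nhdsWithin_le_nhds

theorem eventually_sideLT (γ : Germ α) : ∀ᶠ z in sideNhds γ, SideLT γ.2 γ.1 z :=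
  eventually_mem_nhdsWithin

variable [OrderTopology α]

theorem hasBasis_sideNhds {γ : Germ α} (hγ : GermValid γ) :
    (sideNhds γ).HasBasis (SideLT γ.2 γ.1) (Set.uIoo γ.1) := by
  obtain ⟨x, s⟩ := γ
  obtain ⟨q, hq⟩ := hγ
  rcases hq with ⟨rfl, hq : x < q⟩ | ⟨rfl, hq : q < x⟩
  · simp only [sideNhds, sideLT_one]
    exact (nhdsGT_basis_of_exists_gt ⟨q, hq⟩).congr (fun _ => sideLT_one.symm) fun y hy =>
      (Set.uIoo_of_lt hy).symm
  · simp only [sideNhds, sideLT_neg_one]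
    exact (nhdsLT_basis_of_exists_lt ⟨q, hq⟩).congr (fun _ => sideLT_neg_one.symm) fun y hy =>
      (Set.uIoo_of_gt hy).symm

theorem eventually_mem_uIoo {γ : Germ α} {y : α} (h : SideLT γ.2 γ.1 y) :
    ∀ᶠ z in sideNhds γ, z ∈ Set.uIoo γ.1 y :=
  (hasBasis_sideNhds ⟨y, h⟩).mem_of_mem h

theorem sideNhds_neBot [DenselyOrdered α] {γ : Germ α} (hγ : GermValid γ) :
    (sideNhds γ).NeBot :=
  (hasBasis_sideNhds hγ).neBot_iff.2 fun {_} hy =>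
    let ⟨w, hw, hwy, _⟩ := hy.exists_between hy
    ⟨w, hy.mem_uIoo_iff.2 ⟨hw, hwy⟩⟩

end SideNhds

section GermIterate

variable {α : Type*} [ConditionallyCompleteLinearOrder α] [DenselyOrdered α] [TopologicalSpace α]
  [OrderTopology α] {f : α → α}

theorem eventually_sideLT_iterate (hf : Continuous f) (hT : (turning f).Finite) {γ : Germ α}
    (hγ : GermValid γ) (n : ℕ) :
    ∀ᶠ z in sideNhds γ, SideLT (γ.2 * slopeIter f n γ) (f^[n] γ.1) (f^[n] z) := by
  obtain ⟨q, hq⟩ := hγ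
  obtain ⟨y, -, hy, hs⟩ := exists_strictSlopeOn_iterate hf hT n hq
  filter_upwards [eventually_mem_uIoo hy] with z hz
  exact hs.sideLT Set.left_mem_uIcc (Set.uIoo_subset_uIcc_self hz) (hy.mem_uIoo_iff.1 hz).1

theorem map_iterate_sideNhds (hf : Continuous f) (hT : (turning f).Finite) {γ : Germ α}
    (hγ : GermValid γ) (n : ℕ) :
    map f^[n] (sideNhds γ) = sideNhds ((germMap f)^[n] γ) := by
  apply le_antisymm
  · rw [germMap_iterate]
    exact tendsto_nhdsWithin_iff.2 ⟨((hf.iterate n).tendsto γ.1).mono_left (sideNhds_le_nhds γ),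
      eventually_sideLT_iterate hf hT hγ n⟩
  · intro S hS
    obtain ⟨q, hq, hqS⟩ := (hasBasis_sideNhds hγ).mem_iff.1 (mem_map.1 hS)
    obtain ⟨y, hy, hγy, hs⟩ := exists_strictSlopeOn_iterate hf hT n hq
    have hyS : Set.uIoo γ.1 y ⊆ f^[n] ⁻¹' S := fun z hz => hqS <| by
      rw [hγy.mem_uIoo_iff] at hz
      refine hq.mem_uIoo_iff.2 ⟨hz.1, ?_⟩
      rcases (hq.mem_uIcc_iff.1 hy).2 with rfl | hyq
      exacts [hz.2, hz.2.trans hyq]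
    refine (hasBasis_sideNhds (hγ.germMap_iterate hf hT n)).mem_iff.2 ⟨f^[n] y, ?_, ?_⟩
    all_goals rw [germMap_iterate]
    · exact hs.sideLT_ends hγy
    · exact (uIoo_subset_image_uIoo (hf.iterate n) _ _).trans (Set.image_subset_iff.2 hyS)

theorem side_mul_slope_of_isLocalMin (hf : Continuous f) (hT : (turning f).Finite) {γ : Germ α}
    (hγ : GermValid γ) (h : IsLocalMin f γ.1) : γ.2 * slope f γ = 1 := by
  have := sideNhds_neBot hγ
  obtain ⟨z, hz, hle⟩ :=
    ((eventually_sideLT_iterate hf hT hγ 1).and (sideNhds_le_nhds γ h)).exists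
  rw [slopeIter_one, iterate_one] at hz
  exact hz.elim And.left fun hlt => absurd hle hlt.2.not_ge

theorem side_mul_slope_of_isLocalMax (hf : Continuous f) (hT : (turning f).Finite) {γ : Germ α}
    (hγ : GermValid γ) (h : IsLocalMax f γ.1) : γ.2 * slope f γ = -1 := by
  have := sideNhds_neBot hγ
  obtain ⟨z, hz, hle⟩ :=
    ((eventually_sideLT_iterate hf hT hγ 1).and (sideNhds_le_nhds γ h)).exists
  rw [slopeIter_one, iterate_one] at hz
  exact hz.elim (fun hlt => absurd hle hlt.2.not_ge) And.left

theorem slope_neg_of_mem_turning (hf : Continuous f) (hT : (turning f).Finite) {x : α}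
    (hx : x ∈ turning f) (s : ℤˣ) : slope f (x, -s) = -slope f (x, s) := by
  have heq : -s * slope f (x, -s) = s * slope f (x, s) := by
    rcases hx.2 with hmin | hmax
    · exact (side_mul_slope_of_isLocalMin hf hT (hx.1 (-s)) hmin).trans
        (side_mul_slope_of_isLocalMin hf hT (hx.1 s) hmin).symm
    · exact (side_mul_slope_of_isLocalMax hf hT (hx.1 (-s)) hmax).trans
        (side_mul_slope_of_isLocalMax hf hT (hx.1 s) hmax).symm
  rw [neg_mul, ← mul_neg] at heq
  rw [← mul_left_cancel heq, neg_neg]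

end GermIterate

section Displacement

variable {α : Type*} [ConditionallyCompleteLinearOrder α] [DenselyOrdered α] [TopologicalSpace α]
  [OrderTopology α] {f g : α → α}

open Classical in
/-- The sign of the displacement of `g` along a germ; it is `-1` by convention if the displacement
has no constant sign along the germ. -/
noncomputable def displacementSign {α : Type*} [LinearOrder α] [TopologicalSpace α] (g : α → α)
    (γ : Germ α) : ℤˣ :=
  if ∀ᶠ z in sideNhds γ, z < g z then 1 else -1

theorem displacementSign_eq {γ : Germ α} (hγ : GermValid γ) {σ : ℤˣ}
    (h : ∀ᶠ z in sideNhds γ, SideLT σ z (g z)) : displacementSign g γ = σ := by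
  rcases Int.units_eq_one_or σ with rfl | rfl
  · exact if_pos (h.mono fun z => sideLT_one.1)
  · refine if_neg fun h' => ?_
    have := sideNhds_neBot hγ
    obtain ⟨z, h₁, h₂⟩ := (h.and h').exists
    exact (sideLT_neg_one.1 h₁).not_gt h₂

theorem exists_sideLT_on_gap (hg : Continuous g) {x y : α} (h : ∀ w ∈ Set.uIoo x y, g w ≠ w) :
    ∃ σ : ℤˣ, ∀ z ∈ Set.uIoo x y, SideLT σ z (g z) := by
  by_cases hlt : ∀ z ∈ Set.uIoo x y, z < g z
  · exact ⟨1, fun z hz => sideLT_one.2 (hlt z hz)⟩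
  · push Not at hlt
    obtain ⟨z₀, hz₀, hle⟩ := hlt
    refine ⟨-1, fun z hz => sideLT_neg_one.2 ?_⟩
    by_contra hcon
    obtain ⟨w, hw, he⟩ := isPreconnected_Ioo.intermediate_value₂ hz₀ hz hg.continuousOn
      continuousOn_id hle (not_lt.1 hcon)
    exact h w hw he

theorem eventually_displacementSign (hg : Continuous g) (hfix : (fixedPoints g).Finite)
    {γ : Germ α} (hγ : GermValid γ) :
    ∀ᶠ z in sideNhds γ, SideLT (displacementSign g γ) z (g z) := by
  obtain ⟨q, hq⟩ := hγ
  obtain ⟨y, -, hy, hgap⟩ := exists_gap hfix hq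
  obtain ⟨σ, hσ⟩ := exists_sideLT_on_gap hg hgap
  have hev := (eventually_mem_uIoo hy).mono hσ
  rwa [displacementSign_eq ⟨q, hq⟩ hev]

theorem displacementSign_of_sideLT (hg : Continuous g) {γ : Germ α} (hγ : GermValid γ) {σ : ℤˣ}
    (h : SideLT σ γ.1 (g γ.1)) : displacementSign g γ = σ := by
  refine displacementSign_eq hγ (sideNhds_le_nhds γ ?_)
  rcases h with ⟨rfl, h⟩ | ⟨rfl, h⟩
  · simp only [sideLT_one]
    exact (isOpen_lt continuous_id hg).mem_nhds h
  · simp only [sideLT_neg_one]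
    exact (isOpen_lt hg continuous_id).mem_nhds h

/-- The germ is fixed by `f^n`, and `f^n` moves the nearby points of its side towards its base
point. -/
def IsAttracting {α : Type*} [LinearOrder α] [TopologicalSpace α] (f : α → α) (n : ℕ)
    (γ : Germ α) : Prop :=
  GermValid γ ∧ f^[n] γ.1 = γ.1 ∧
    ∀ᶠ z in sideNhds γ, SideLT γ.2 γ.1 (f^[n] z) ∧ SideLT γ.2 (f^[n] z) z

theorem isAttracting_iff (hf : Continuous f) (hT : (turning f).Finite) {n : ℕ}
    (hfix : (fixedPoints f^[n]).Finite) {γ : Germ α} (hγ : GermValid γ) (hx : f^[n] γ.1 = γ.1) :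
    IsAttracting f n γ ↔ slopeIter f n γ = 1 ∧ displacementSign f^[n] γ = -γ.2 := by
  have hslope := eventually_sideLT_iterate hf hT hγ n
  have hdisp := eventually_displacementSign (hf.iterate n) hfix hγ
  have := sideNhds_neBot hγ
  rw [hx] at hslope
  constructor
  · rintro ⟨-, -, hattr⟩
    obtain ⟨z, hz, hz', hxz, hzz⟩ := (hslope.and (hdisp.and hattr)).exists
    exact ⟨mul_eq_left.1 (hz.unique hxz), hz'.unique (sideLT_neg.2 hzz)⟩
  · rintro ⟨h₁, h₂⟩
    rw [h₁, mul_one] at hslope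
    simp only [h₂, sideLT_neg] at hdisp
    exact ⟨hγ, hx, hslope.and hdisp⟩

theorem displacementSign_of_slopeIter_eq_neg_one (hf : Continuous f) (hT : (turning f).Finite)
    {n : ℕ} (hfix : (fixedPoints f^[n]).Finite) {γ : Germ α} (hγ : GermValid γ)
    (hx : f^[n] γ.1 = γ.1) (hs : slopeIter f n γ = -1) : displacementSign f^[n] γ = -γ.2 := by
  have hslope := eventually_sideLT_iterate hf hT hγ n
  have := sideNhds_neBot hγ
  obtain ⟨z, hz, hz', hxz⟩ := (hslope.and
    ((eventually_displacementSign (hf.iterate n) hfix hγ).and (eventually_sideLT γ))).exists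
  rw [hx, hs, mul_neg_one] at hz
  exact hz'.unique ((sideLT_neg.2 hxz).trans hz)

/-- Half the product of the slope of `f^n` and the sign of its displacement along a germ. Its jumps
count the fixed points of `f^n`. -/
noncomputable def displacement {α : Type*} [LinearOrder α] [TopologicalSpace α] (f : α → α) (n : ℕ)
    (γ : Germ α) : ℚ :=
  sgn (slopeIter f n γ) * sgn (displacementSign f^[n] γ) / 2

open Classical in
theorem displacement_of_fixed (hf : Continuous f) (hT : (turning f).Finite) {n : ℕ}
    (hfix : (fixedPoints f^[n]).Finite) {γ : Germ α} (hγ : GermValid γ) (hx : f^[n] γ.1 = γ.1) :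
    displacement f n γ = sgn γ.2 * (1 / 2 - if IsAttracting f n γ then 1 else 0) := by
  rw [isAttracting_iff hf hT hfix hγ hx, displacement]
  rcases Int.units_eq_one_or (slopeIter f n γ) with hs | hs
  · have hσ : displacementSign f^[n] γ = γ.2 ∨ displacementSign f^[n] γ = -γ.2 := by
      rcases Int.units_eq_one_or γ.2 with h | h <;> simpa [h, or_comm] using
        Int.units_eq_one_or (displacementSign f^[n] γ)
    rcases hσ with hσ | hσ
    · have hne : γ.2 ≠ -γ.2 := units_ne_neg_self γ.2
      simp only [hs, hσ, hne, map_one, and_false, if_false]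
      ring
    · simp only [hs, hσ, map_one, sgn_neg, and_self, if_true]
      ring
  · simp only [hs, displacementSign_of_slopeIter_eq_neg_one hf hT hfix hγ hx hs, sgn_neg, map_one,
      show (-1 : ℤˣ) ≠ 1 by decide, false_and, if_false]
    ring

theorem gapConst_displacement (hf : Continuous f) (n : ℕ) :
    GapConst (displacement f n) (turningIter f n ∪ fixedPoints f^[n]) := by
  intro x y hxy h
  have hslope := slopeIter_eq_of_gap hf n hxy fun w hw hw' => h w hw (Or.inl hw')
  rw [← Set.uIoo_of_lt hxy] at h
  obtain ⟨σ, hσ⟩ := exists_sideLT_on_gap (hf.iterate n) fun w hw hw' => h w hw (Or.inr hw')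
  have hright : SideLT 1 x y := sideLT_one.2 hxy
  have hleft : SideLT (-1) y x := sideLT_neg_one.2 hxy
  rw [displacement, displacement, hslope,
    displacementSign_eq ⟨y, hright⟩ ((eventually_mem_uIoo (γ := (x, 1)) hright).mono hσ),
    displacementSign_eq ⟨x, hleft⟩ ((eventually_mem_uIoo (γ := (y, -1)) hleft).mono
      (by rwa [Set.uIoo_comm]))]

end Displacement

section GapConstEnds

variable {α : Type*} [LinearOrder α]

theorem GapConst.inter_innerPoints {M : Type*} {ψ : Germ α → M} {V : Set α} (h : GapConst ψ V) :
    GapConst ψ (V ∩ innerPoints α) :=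
  fun x y hxy hgap => h x y hxy fun w hw hwV => hgap w hw ⟨hwV, mem_innerPoints_of_mem_Ioo hw⟩

theorem GapConst.top_sub_bot [BoundedOrder α] {V : Finset α} {ψ : Germ α → ℚ} (h : GapConst ψ V)
    (hV : (V : Set α) ⊆ innerPoints α) (hlt : (⊥ : α) < ⊤) :
    ψ (⊤, -1) - ψ (⊥, 1) = ∑ w ∈ V, (ψ (w, 1) - ψ (w, -1)) := by
  rw [innerPoints_eq_Ioo] at hV
  have hbot := h.eq_add_sum hV (γ := (⊥, 1)) ⟨⊤, sideLT_one.2 hlt⟩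
  rw [Finset.sum_congr rfl fun w hw => by
    rw [position_of_sideLT (γ := (⊥, 1)) (sideLT_neg_one.2 (hV hw).1)], ← Finset.sum_mul] at hbot
  rw [sgn_neg, map_one] at hbot
  linear_combination -2 * hbot

end GapConstEnds

section FirstHit

variable {α : Type*}

/-- The inner points whose orbit first hits the turning set at time `j`, at the point `l`. -/
def firstHit [LinearOrder α] [TopologicalSpace α] (f : α → α) (j : ℕ) (l : α) : Set α :=
  {w ∈ innerPoints α | f^[j] w = l ∧ ∀ i < j, f^[i] w ∉ turning f}

/-- The inner points whose orbit hits the turning set before time `n`: the ends of the laps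
of `f^n`. -/
def crit [LinearOrder α] [TopologicalSpace α] (f : α → α) (n : ℕ) : Set α :=
  turningIter f n ∩ innerPoints α

/-- The signed itinerary, with respect to the point `i`, of a germ. -/
noncomputable def signedPosition [LinearOrder α] (f : α → α) (i : α) (n : ℕ) (γ : Germ α) : ℚ :=
  sgn (slopeIter f n γ) * position ((germMap f)^[n] γ) i

section Crit

variable [LinearOrder α] [TopologicalSpace α] {f : α → α}

theorem mem_crit_iff {n : ℕ} {w : α} :
    w ∈ crit f n ↔ ∃ j < n, ∃ l ∈ turning f, w ∈ firstHit f j l := by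
  classical
  constructor
  · rintro ⟨⟨j, hj, hw⟩, hw'⟩
    have hex : ∃ j, f^[j] w ∈ turning f := ⟨j, hw⟩
    exact ⟨Nat.find hex, (Nat.find_min' hex hw).trans_lt hj, _, Nat.find_spec hex, hw', rfl,
      fun i hi => Nat.find_min hex hi⟩
  · rintro ⟨j, hj, l, hl, hw, rfl, -⟩
    exact ⟨⟨j, hj, hl⟩, hw⟩

theorem firstHit_unique {j j' : ℕ} {l l' : α} (hl : l ∈ turning f) (hl' : l' ∈ turning f) {w : α}
    (h : w ∈ firstHit f j l) (h' : w ∈ firstHit f j' l') : j = j' ∧ l = l' := by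
  obtain ⟨-, rfl, hlt⟩ := h
  obtain ⟨-, rfl, hlt'⟩ := h'
  have hj : j = j' := le_antisymm (not_lt.1 fun h => hlt j' h hl') (not_lt.1 fun h => hlt' j h hl)
  exact ⟨hj, hj ▸ rfl⟩

theorem mapsTo_innerPoints_sdiff_turning :
    Set.MapsTo f (innerPoints α \ turning f) (innerPoints α) := by
  rintro x ⟨hx, hxT⟩ s
  by_contra h
  refine hxT ⟨hx, ?_⟩
  rcases Int.units_eq_one_or s with rfl | rfl
  · exact Or.inr (Eventually.of_forall fun y => not_lt.1 fun hy => h ⟨f y, sideLT_one.2 hy⟩)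
  · exact Or.inl (Eventually.of_forall fun y => not_lt.1 fun hy => h ⟨f y, sideLT_neg_one.2 hy⟩)

theorem iterate_mem_innerPoints {w : α} (hw : w ∈ innerPoints α) {j : ℕ}
    (h : ∀ i < j, f^[i] w ∉ turning f) : f^[j] w ∈ innerPoints α := by
  induction j with
  | zero => exact hw
  | succ j ih =>
    rw [iterate_succ_apply']
    exact mapsTo_innerPoints_sdiff_turning ⟨ih fun i hi => h i (hi.trans j.lt_succ_self),
      h j j.lt_succ_self⟩

end Crit

variable [ConditionallyCompleteLinearOrder α] [DenselyOrdered α] [TopologicalSpace α]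
  [OrderTopology α] {f : α → α}

theorem finite_firstHit (hf : Continuous f) (hT : (turning f).Finite) (j : ℕ) (l : α) :
    (firstHit f j l).Finite :=
  (finite_preimage_iterate hf hT (Set.finite_singleton l) j).subset fun _ hw => hw.2.1

theorem finite_crit (hf : Continuous f) (hT : (turning f).Finite) (n : ℕ) : (crit f n).Finite :=
  (finite_turningIter hf hT n).inter_of_left _

theorem finsum_mem_crit {M : Type*} [AddCommMonoid M] (hf : Continuous f) [Fintype (turning f)]
    (n : ℕ) (F : α → M) :
    ∑ᶠ w ∈ crit f n, F w =
      ∑ j ∈ Finset.range n, ∑ l : turning f, ∑ᶠ w ∈ firstHit f j l, F w := by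
  have hcrit : crit f n =
      ⋃ p ∈ (Finset.range n ×ˢ Finset.univ : Finset (ℕ × turning f)), firstHit f p.1 p.2 := by
    ext w
    simp [mem_crit_iff]
  rw [hcrit, ← Finset.sum_product']
  refine (finsum_mem_biUnion (fun p _ q _ hpq => ?_) (Finset.finite_toSet _)
    fun p _ => finite_firstHit hf (Set.toFinite _) p.1 p.2).trans (finsum_mem_coe_finset _ _)
  exact Set.disjoint_left.2 fun w hp hq =>
    let ⟨hj, hl⟩ := firstHit_unique p.2.2 q.2.2 hp hq
    hpq (Prod.ext hj (Subtype.ext hl))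

theorem slopeIter_neg_of_forall_notMem_turning (hf : Continuous f) (hT : (turning f).Finite)
    {w : α} (hw : w ∈ innerPoints α) {j : ℕ} (h : ∀ i < j, f^[i] w ∉ turning f) (s : ℤˣ) :
    slopeIter f j (w, -s) = slopeIter f j (w, s) := by
  induction j with
  | zero => rfl
  | succ j ih =>
    have hlt : ∀ i < j, f^[i] w ∉ turning f := fun i hi => h i (hi.trans j.lt_succ_self)
    rw [slopeIter_succ', slopeIter_succ', germMap_iterate, germMap_iterate, ih hlt, neg_mul,
      slope_neg_of_notMem_turning hf hT (iterate_mem_innerPoints hw hlt) (h j j.lt_succ_self)]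

theorem germMap_neg_of_mem_turning (hf : Continuous f) (hT : (turning f).Finite) {l : α}
    (hl : l ∈ turning f) (s : ℤˣ) : germMap f (l, -s) = germMap f (l, s) := by
  rw [germMap, germMap, slope_neg_of_mem_turning hf hT hl, neg_mul_neg]

theorem slopeIter_neg_of_mem_turning (hf : Continuous f) (hT : (turning f).Finite) {l : α}
    (hl : l ∈ turning f) (s : ℤˣ) {m : ℕ} (hm : m ≠ 0) :
    slopeIter f m (l, -s) = -slopeIter f m (l, s) := by
  obtain ⟨m, rfl⟩ := Nat.exists_eq_succ_of_ne_zero hm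
  rw [slopeIter_succ, slopeIter_succ, germMap_neg_of_mem_turning hf hT hl,
    slope_neg_of_mem_turning hf hT hl, neg_mul]

theorem signedPosition_neg_of_mem_turning (hf : Continuous f) (hT : (turning f).Finite) {l : α}
    (hl : l ∈ turning f) (i : α) (s : ℤˣ) {m : ℕ} (hm : m ≠ 0) :
    signedPosition f i m (l, -s) = -signedPosition f i m (l, s) := by
  have hgerm : (germMap f)^[m] (l, -s) = (germMap f)^[m] (l, s) := by
    rw [germMap_iterate, germMap_iterate, slopeIter_neg_of_mem_turning hf hT hl s hm, neg_mul_neg]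
  rw [signedPosition, signedPosition, hgerm, slopeIter_neg_of_mem_turning hf hT hl s hm, sgn_neg,
    neg_mul]

theorem germMap_iterate_of_mem_firstHit (hf : Continuous f) (hT : (turning f).Finite) {j : ℕ}
    {l w : α} (hw : w ∈ firstHit f j l) (s : ℤˣ) :
    (germMap f)^[j] (w, s) = (l, s * slopeIter f j (w, 1)) ∧
      slopeIter f j (w, s) = slopeIter f j (w, 1) := by
  have hslope : slopeIter f j (w, s) = slopeIter f j (w, 1) := by
    rcases Int.units_eq_one_or s with rfl | rfl
    exacts [rfl, slopeIter_neg_of_forall_notMem_turning hf hT hw.1 hw.2.2 1]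
  refine ⟨?_, hslope⟩
  rw [germMap_iterate, hslope, hw.2.1]

theorem slopeIter_add_of_mem_firstHit (hf : Continuous f) (hT : (turning f).Finite) {j : ℕ}
    {l w : α} (hw : w ∈ firstHit f j l) (s : ℤˣ) (m : ℕ) :
    slopeIter f (j + m) (w, s) =
      slopeIter f j (w, 1) * slopeIter f m (l, s * slopeIter f j (w, 1)) := by
  obtain ⟨hgerm, hslope⟩ := germMap_iterate_of_mem_firstHit hf hT hw s
  rw [slopeIter_add, hgerm, hslope]

theorem signedPosition_of_mem_firstHit (hf : Continuous f) (hT : (turning f).Finite) {j : ℕ}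
    {l w : α} (hw : w ∈ firstHit f j l) (i : α) (s : ℤˣ) (m : ℕ) :
    signedPosition f i (j + m) (w, s) =
      sgn (slopeIter f j (w, 1)) * signedPosition f i m (l, s * slopeIter f j (w, 1)) := by
  rw [signedPosition, signedPosition, slopeIter_add_of_mem_firstHit hf hT hw, add_comm j m,
    iterate_add_apply, (germMap_iterate_of_mem_firstHit hf hT hw s).1, map_mul, mul_assoc]

theorem signedPosition_jump_of_mem_firstHit (hf : Continuous f) (hT : (turning f).Finite) {j : ℕ}
    {l w : α} (hw : w ∈ firstHit f j l) (i : α) (m : ℕ) :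
    signedPosition f i (j + m) (w, 1) - signedPosition f i (j + m) (w, -1) =
      signedPosition f i m (l, 1) - signedPosition f i m (l, -1) := by
  rw [signedPosition_of_mem_firstHit hf hT hw, signedPosition_of_mem_firstHit hf hT hw]
  rcases Int.units_eq_one_or (slopeIter f j (w, 1)) with h | h <;>
    simp only [h, sgn_neg, map_one, mul_one, mul_neg, neg_neg] <;> ring

theorem signedPosition_eq_of_mem_firstHit (hf : Continuous f) (hT : (turning f).Finite) {j : ℕ}
    {l w : α} (hl : l ∈ turning f) (hw : w ∈ firstHit f j l) (i : α) (s : ℤˣ) {m : ℕ}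
    (hm : m ≠ 0) : signedPosition f i (j + m) (w, s) = signedPosition f i m (l, s) := by
  rw [signedPosition_of_mem_firstHit hf hT hw]
  rcases Int.units_eq_one_or (slopeIter f j (w, 1)) with h | h
  · rw [h, map_one, one_mul, mul_one]
  · rw [h, mul_neg_one, signedPosition_neg_of_mem_turning hf hT hl i s hm, sgn_neg, map_one,
      neg_one_mul, neg_neg]

theorem slopeIter_neg_of_mem_crit (hf : Continuous f) (hT : (turning f).Finite) {n : ℕ} {w : α}
    (hw : w ∈ crit f n) (s : ℤˣ) : slopeIter f n (w, -s) = -slopeIter f n (w, s) := by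
  obtain ⟨j, hj, l, hl, hjl⟩ := mem_crit_iff.1 hw
  obtain ⟨m, rfl⟩ := Nat.exists_eq_add_of_lt hj
  rw [add_assoc, slopeIter_add_of_mem_firstHit hf hT hjl, slopeIter_add_of_mem_firstHit hf hT hjl,
    neg_mul, slopeIter_neg_of_mem_turning hf hT hl _ m.succ_ne_zero, mul_neg]

end FirstHit

section Count

variable {α : Type*}

/-- The fixed points of `f^n` which are an end of a lap of `f^n`, or an end of the space. -/
def lapEndFixedPts [LinearOrder α] [TopologicalSpace α] (f : α → α) (n : ℕ) : Set α :=
  {x ∈ fixedPoints f^[n] | x ∈ crit f n ∨ x ∉ innerPoints α}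

/-- The sum of the signed itineraries at time `n` of the ends of the laps of `f^n`, each taken with
respect to the starting point. -/
noncomputable def critSum [LinearOrder α] [TopologicalSpace α] (f : α → α) (n : ℕ) : ℚ :=
  ∑ᶠ w ∈ crit f n, signedPosition f w n (w, -1)

theorem sum_indicator_eq_finsum_mem {M : Type*} [AddCommMonoid M] {S : Set α} {V : Finset α}
    (h : S ⊆ V) (g : α → M) : ∑ w ∈ V, S.indicator g w = ∑ᶠ w ∈ S, g w := by
  rw [finsum_mem_def]
  exact (finsum_eq_sum_of_support_subset _ ((Set.support_indicator_subset).trans h)).symm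

theorem signedPosition_of_fixed [LinearOrder α] {f : α → α} {n : ℕ} {w : α}
    (hx : f^[n] w = w) (s : ℤˣ) :
    signedPosition f w n (w, s) = sgn s / 2 := by
  rw [signedPosition, germMap_iterate, hx, position_self, map_mul]
  linear_combination sgn s / 2 * sgn_mul_self (slopeIter f n (w, s))

open Classical in
theorem ncard_isAttracting [LinearOrder α] [TopologicalSpace α] {f : α → α} {n : ℕ}
    {V : Finset α} (hV : fixedPoints f^[n] ⊆ V) :
    ({γ | IsAttracting f n γ}.ncard : ℚ) =
      ∑ w ∈ V, ∑ s : ℤˣ, if IsAttracting f n (w, s) then 1 else 0 := by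
  have hcoe : {γ | IsAttracting f n γ} =
      ((V ×ˢ (Finset.univ : Finset ℤˣ)).filter fun γ => IsAttracting f n γ : Finset (Germ α)) := by
    ext γ
    simp only [Set.mem_ofPred_eq, Finset.coe_filter, Finset.mem_product, Finset.mem_univ, and_true]
    exact ⟨fun h => ⟨hV h.2.1, h⟩, And.right⟩
  rw [hcoe, Set.ncard_coe_finset, ← Finset.sum_boole, Finset.sum_product]

open Classical in
theorem ncard_isAttracting_of_innerPoints [LinearOrder α] [BoundedOrder α] [TopologicalSpace α]
    {f : α → α} (hlt : (⊥ : α) < ⊤) {n : ℕ} {V : Finset α} (hV : (V : Set α) ⊆ innerPoints α)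
    (hfix : fixedPoints f^[n] ∩ innerPoints α ⊆ V) :
    ({γ | IsAttracting f n γ}.ncard : ℚ) =
      (if IsAttracting f n (⊥, 1) then 1 else 0) + (if IsAttracting f n (⊤, -1) then 1 else 0) +
        ∑ w ∈ V, ∑ s : ℤˣ, if IsAttracting f n (w, s) then 1 else 0 := by
  rw [innerPoints_eq_Ioo] at hV hfix
  have hfix' : fixedPoints f^[n] ⊆ (insert ⊥ (insert ⊤ V) : Finset α) := fun x hx => by
    rw [Finset.mem_coe, Finset.mem_insert, Finset.mem_insert]
    rcases eq_or_ne x ⊥ with h | hbot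
    · exact Or.inl h
    · rcases eq_or_ne x ⊤ with h | htop
      exacts [Or.inr (Or.inl h), Or.inr (Or.inr (hfix ⟨hx, hbot.bot_lt, htop.lt_top⟩))]
  have hbot : (⊥ : α) ∉ insert ⊤ V := by
    rw [Finset.mem_insert, not_or]
    exact ⟨hlt.ne, fun h => (hV h).1.false⟩
  have hbot_left : ¬ IsAttracting f n (⊥, -1) := fun h => h.1.bot_lt.false
  have htop_right : ¬ IsAttracting f n (⊤, 1) := fun h => h.1.lt_top.false
  rw [ncard_isAttracting hfix', Finset.sum_insert hbot,
    Finset.sum_insert fun h => (hV h).2.false,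
    show (Finset.univ : Finset ℤˣ) = {1, -1} from rfl, Finset.sum_pair (by decide),
    Finset.sum_pair (by decide), if_neg hbot_left, if_neg htop_right]
  ring

variable [ConditionallyCompleteLinearOrder α] [DenselyOrdered α] [TopologicalSpace α]
  [OrderTopology α] {f : α → α}

theorem slopeIter_eq_one_of_end (hf : Continuous f) (hT : (turning f).Finite) {n : ℕ}
    {γ : Germ α} (hγ : GermValid γ) (hend : ¬ GermValid (γ.1, -γ.2)) (hx : f^[n] γ.1 = γ.1) :
    slopeIter f n γ = 1 := by
  have h := hγ.germMap_iterate hf hT n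
  rw [germMap_iterate, hx] at h
  refine (Int.units_eq_one_or _).resolve_right fun hneg => hend ?_
  rwa [hneg, mul_neg_one] at h

open Classical in
theorem displacement_of_end (hf : Continuous f) (hT : (turning f).Finite) {n : ℕ}
    (hfix : (fixedPoints f^[n]).Finite) {γ : Germ α} (hγ : GermValid γ)
    (hend : ¬ GermValid (γ.1, -γ.2)) :
    displacement f n γ =
      sgn γ.2 * (sgn (slopeIter f n γ) / 2 - if IsAttracting f n γ then 1 else 0) := by
  by_cases hx : f^[n] γ.1 = γ.1
  · rw [displacement_of_fixed hf hT hfix hγ hx, slopeIter_eq_one_of_end hf hT hγ hend hx, map_one]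
  · have hlt : SideLT γ.2 γ.1 (f^[n] γ.1) :=
      (sideLT_or_sideLT γ.2 hx).resolve_left fun h => hend ⟨_, sideLT_neg.2 h⟩
    rw [displacement, displacementSign_of_sideLT (hf.iterate n) hγ hlt, if_neg fun h => hx h.2.1]
    ring

open Classical in
theorem displacement_jump_of_fixed (hf : Continuous f) (hT : (turning f).Finite) {n : ℕ}
    (hfix : (fixedPoints f^[n]).Finite) {w : α} (hw : w ∈ innerPoints α) (hx : f^[n] w = w) :
    displacement f n (w, 1) - displacement f n (w, -1) =
      1 - ∑ s : ℤˣ, if IsAttracting f n (w, s) then 1 else 0 := by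
  rw [displacement_of_fixed hf hT hfix (hw 1) hx, displacement_of_fixed hf hT hfix (hw (-1)) hx,
    show (Finset.univ : Finset ℤˣ) = {1, -1} from rfl, Finset.sum_pair (by decide), sgn_neg,
    map_one]
  ring

theorem displacement_jump_of_mem_crit (hf : Continuous f) (hT : (turning f).Finite) {n : ℕ} {w : α}
    (hw : w ∈ crit f n) (hx : f^[n] w ≠ w) :
    displacement f n (w, 1) - displacement f n (w, -1) = -2 * signedPosition f w n (w, -1) := by
  obtain ⟨σ, hσ⟩ := exists_sideLT_of_ne hx.symm
  have hsign : ∀ s, displacementSign f^[n] (w, s) = σ := fun s =>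
    displacementSign_of_sideLT (hf.iterate n) (hw.2 s) hσ
  have hpos : position ((germMap f)^[n] (w, -1)) w = sgn σ / 2 := by
    rw [germMap_iterate]
    exact position_of_sideLT hσ
  have hslope := slopeIter_neg_of_mem_crit hf hT hw 1
  rw [displacement, displacement, signedPosition, hsign, hsign, hpos, hslope, sgn_neg]
  ring

open Classical in
theorem displacement_jump (hf : Continuous f) (hT : (turning f).Finite) {n : ℕ}
    (hfix : (fixedPoints f^[n]).Finite) {w : α}
    (hw : w ∈ (turningIter f n ∪ fixedPoints f^[n]) ∩ innerPoints α) :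
    displacement f n (w, 1) - displacement f n (w, -1) =
      (fixedPoints f^[n] \ lapEndFixedPts f n).indicator 1 w -
        2 * (crit f n).indicator (fun w => signedPosition f w n (w, -1)) w -
        ∑ s : ℤˣ, if IsAttracting f n (w, s) then 1 else 0 := by
  by_cases hx : f^[n] w = w
  · rw [displacement_jump_of_fixed hf hT hfix hw.2 hx]
    by_cases hcrit : w ∈ crit f n
    · rw [Set.indicator_of_notMem fun h => h.2 ⟨hx, Or.inl hcrit⟩, Set.indicator_of_mem hcrit,
        signedPosition_of_fixed hx, sgn_neg, map_one]
      ring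
    · have hinner : w ∈ fixedPoints f^[n] \ lapEndFixedPts f n :=
        ⟨hx, fun h => h.2.elim hcrit (· hw.2)⟩
      rw [Set.indicator_of_mem hinner, Set.indicator_of_notMem hcrit, Pi.one_apply]
      ring
  · have hcrit : w ∈ crit f n := ⟨hw.1.resolve_right hx, hw.2⟩
    rw [displacement_jump_of_mem_crit hf hT hcrit hx, Set.indicator_of_mem hcrit,
      Set.indicator_of_notMem fun h => hx h.1,
      Finset.sum_eq_zero fun s _ => if_neg fun h => hx h.2.1]
    ring

open Classical in
theorem ncard_isAttracting_add_sum_displacement_jump (hf : Continuous f) (hT : (turning f).Finite)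
    {n : ℕ} (hfix : (fixedPoints f^[n]).Finite) {V : Finset α}
    (hV : (V : Set α) = (turningIter f n ∪ fixedPoints f^[n]) ∩ innerPoints α) :
    ∑ w ∈ V, (displacement f n (w, 1) - displacement f n (w, -1)) +
        ∑ w ∈ V, ∑ s : ℤˣ, (if IsAttracting f n (w, s) then 1 else 0) =
      ((fixedPoints f^[n]).ncard : ℚ) - (lapEndFixedPts f n).ncard - 2 * critSum f n := by
  have hinner : fixedPoints f^[n] \ lapEndFixedPts f n ⊆ V := by
    rw [hV]
    exact fun x hx => ⟨Or.inr hx.1, by_contra fun h => hx.2 ⟨hx.1, Or.inr h⟩⟩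
  have hcrit : crit f n ⊆ V := by
    rw [hV]
    exact fun x hx => ⟨Or.inl hx.1, hx.2⟩
  have hone : ∑ᶠ w ∈ fixedPoints f^[n] \ lapEndFixedPts f n, (1 : α → ℚ) w =
      (fixedPoints f^[n] \ lapEndFixedPts f n).ncard := by
    rw [← finsum_one, Nat.cast_finsum_mem (hfix.subset Set.sdiff_subset)]
    simp only [Pi.one_apply, Nat.cast_one]
  have hcard := Set.ncard_sdiff_add_ncard_of_subset
    (show lapEndFixedPts f n ⊆ fixedPoints f^[n] from fun x hx => hx.1) hfix
  rw [Finset.sum_congr rfl fun w hw => displacement_jump hf hT hfix (hV ▸ Finset.mem_coe.2 hw),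
    Finset.sum_sub_distrib, Finset.sum_sub_distrib, ← Finset.mul_sum,
    sum_indicator_eq_finsum_mem hinner, sum_indicator_eq_finsum_mem hcrit, hone, ← hcard, critSum]
  push_cast
  ring

theorem ncard_fixedPoints [BoundedOrder α] (hf : Continuous f) (hT : (turning f).Finite)
    (hlt : (⊥ : α) < ⊤) {n : ℕ} (hfix : (fixedPoints f^[n]).Finite) :
    ((fixedPoints f^[n]).ncard : ℚ) = (lapEndFixedPts f n).ncard +
      {γ | IsAttracting f n γ}.ncard + 2 * critSum f n -
      (sgn (slopeIter f n (⊤, -1)) + sgn (slopeIter f n (⊥, 1))) / 2 := by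
  classical
  have hfin : ((turningIter f n ∪ fixedPoints f^[n]) ∩ innerPoints α).Finite :=
    ((finite_turningIter hf hT n).union hfix).inter_of_left _
  set V := hfin.toFinset
  have hV : (V : Set α) = (turningIter f n ∪ fixedPoints f^[n]) ∩ innerPoints α :=
    hfin.coe_toFinset
  have hVinner : (V : Set α) ⊆ innerPoints α := hV ▸ Set.inter_subset_right
  have hattr := ncard_isAttracting_of_innerPoints (f := f) hlt hVinner (n := n) fun x hx =>
    hV ▸ (⟨Or.inr hx.1, hx.2⟩ : x ∈ (turningIter f n ∪ fixedPoints f^[n]) ∩ innerPoints α)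
  have hsum := ncard_isAttracting_add_sum_displacement_jump hf hT hfix hV
  rw [← GapConst.top_sub_bot (hV ▸ (gapConst_displacement hf n).inter_innerPoints) hVinner hlt,
    displacement_of_end hf hT hfix (γ := (⊤, -1)) ⟨⊥, sideLT_neg_one.2 hlt⟩
      fun h => h.lt_top.false,
    displacement_of_end hf hT hfix (γ := (⊥, 1)) ⟨⊤, sideLT_one.2 hlt⟩ fun h => h.bot_lt.false,
    sgn_neg, map_one] at hsum
  linear_combination -hattr - hsum

end Count

section SideOrbits

variable {α : Type*} [LinearOrder α] {g : α → α}

theorem mapsTo_uIoo_of_not_sideLT {s : ℤˣ} {x y : α} (hxy : SideLT s x y)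
    (h : ∀ z ∈ Set.uIoo x y, SideLT s x (g z) ∧ ¬ SideLT s z (g z)) :
    Set.MapsTo g (Set.uIoo x y) (Set.uIoo x y) := by
  intro z hz
  obtain ⟨hxg, hzg⟩ := h z hz
  refine hxy.mem_uIoo_iff.2 ⟨hxg, ?_⟩
  have hzy := (hxy.mem_uIoo_iff.1 hz).2
  rcases eq_or_ne z (g z) with heq | hne
  · rwa [← heq]
  · exact ((sideLT_or_sideLT s hne).resolve_left hzg).trans hzy

theorem eventually_sideLT_iterate_of_tendsto {l : Filter α} {s : ℤˣ}
    (hg : Tendsto g l l) (h : ∀ᶠ z in l, SideLT s z (g z)) {k : ℕ} (hk : 0 < k) :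
    ∀ᶠ z in l, SideLT s z (g^[k] z) := by
  induction k, hk using Nat.le_induction with
  | base => exact h
  | succ k _ ih =>
    filter_upwards [h, hg.eventually ih] with z hz hgz
    exact hz.trans hgz

end SideOrbits

section Through

variable {β : Type*} {h : β → β} {V : Set β}

/-- The periodic points whose orbit meets `V`. -/
def periodicPtsThrough (h : β → β) (V : Set β) : Set β :=
  {x ∈ periodicPts h | ∃ j, h^[j] x ∈ V}

theorem finite_periodicPtsThrough (hV : V.Finite) : (periodicPtsThrough h V).Finite := by
  refine (hV.biUnion (t := fun v => (fun i => h^[i] v) '' Set.Iio (minimalPeriod h v))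
    fun v _ => (Set.finite_Iio _).image _).subset ?_
  rintro x ⟨⟨n, hn, hx⟩, j, hj⟩
  have hv : IsPeriodicPt h n (h^[j] x) := hx.apply_iterate j
  refine Set.mem_biUnion hj ⟨(n * j - j) % minimalPeriod h (h^[j] x),
    Nat.mod_lt _ (hv.minimalPeriod_pos hn), ?_⟩
  dsimp only
  rw [iterate_mod_minimalPeriod_eq, ← iterate_add_apply,
    Nat.sub_add_cancel (Nat.le_mul_of_pos_left j hn)]
  exact hx.mul_const j

theorem mapsTo_periodicPtsThrough :
    Set.MapsTo h (periodicPtsThrough h V) (periodicPtsThrough h V) := by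
  rintro x ⟨⟨n, hn, hx⟩, j, hj⟩
  refine ⟨⟨n, hn, hx.apply_iterate 1⟩, j + n - 1, ?_⟩
  rwa [← iterate_succ_apply, show (j + n - 1).succ = j + n by omega, iterate_add_apply, hx.eq]

theorem lapEndFixedPts_eq [LinearOrder β] [TopologicalSpace β] {n : ℕ} (hn : 0 < n) :
    lapEndFixedPts h n =
      periodicPtsThrough h (turning h ∪ (innerPoints β)ᶜ) ∩ fixedPoints h^[n] := by
  ext x
  constructor
  · rintro ⟨hx, ⟨⟨j, -, hj⟩, -⟩ | hend⟩
    · exact ⟨⟨⟨n, hn, hx⟩, j, Or.inl hj⟩, hx⟩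
    · exact ⟨⟨⟨n, hn, hx⟩, 0, Or.inr hend⟩, hx⟩
  · rintro ⟨⟨-, j, hj⟩, hx⟩
    refine ⟨hx, or_iff_not_imp_right.2 fun hinner => ?_⟩
    rw [not_not] at hinner
    obtain ⟨i, hi⟩ : ∃ i, h^[i] x ∈ turning h := by
      by_contra! hnot
      exact hj.elim (hnot j) (· (iterate_mem_innerPoints hinner fun i _ => hnot i))
    rw [← IsPeriodicPt.iterate_mod_apply hx i] at hi
    exact ⟨⟨i % n, Nat.mod_lt _ hn, hi⟩, hinner⟩

end Through

section Periodic

variable {α : Type*} [ConditionallyCompleteLinearOrder α] [DenselyOrdered α] [TopologicalSpace α]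
  [OrderTopology α] {f g : α → α}

theorem not_isRepellingPeriodicPt (hf : Continuous f) {n : ℕ} (hn : 0 < n) {γ : Germ α}
    (hγ : GermValid γ) (hx : f^[n] γ.1 = γ.1)
    (h : ∀ᶠ z in sideNhds γ, SideLT γ.2 γ.1 (f^[n] z) ∧ ¬ SideLT γ.2 z (f^[n] z)) :
    ¬ IsRepellingPeriodicPt f γ.1 := by
  rintro ⟨-, U, hU, hxU, hrep⟩
  obtain ⟨r, hr⟩ := IsPeriodicPt.minimalPeriod_dvd hx
  set p := minimalPeriod f γ.1
  have hr₀ : 0 < r := Nat.pos_of_ne_zero (by rintro rfl; omega)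
  have hnear : ∀ᶠ z in 𝓝 γ.1, ∀ i ∈ Set.Iio r, f^[p * i] z ∈ U :=
    (eventually_all_finite (Set.finite_Iio r)).2 fun i _ =>
      (hf.iterate (p * i)).continuousAt (hU.mem_nhds <| by
        rwa [((isPeriodicPt_minimalPeriod f γ.1).mul_const i).eq])
  obtain ⟨y, hy, hyP⟩ :=
    (hasBasis_sideNhds hγ).mem_iff.1 (h.and (sideNhds_le_nhds γ hnear))
  have hmaps : Set.MapsTo f^[n] (Set.uIoo γ.1 y) (Set.uIoo γ.1 y) :=
    mapsTo_uIoo_of_not_sideLT hy fun z hz => (hyP hz).1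
  obtain ⟨u, hγu, huy, -⟩ := hy.exists_between hy
  have hu : u ∈ Set.uIoo γ.1 y := hy.mem_uIoo_iff.2 ⟨hγu, huy⟩
  have huU : u ∈ U := (hyP hu).2 0 hr₀
  obtain ⟨k, hk⟩ := hrep u huU hγu.ne.symm
  have hkr : p * k = p * (k % r) + n * (k / r) := by
    rw [hr, mul_assoc, ← mul_add, Nat.mod_add_div]
  rw [hkr, iterate_add_apply, iterate_mul f n] at hk
  exact hk ((hyP (hmaps.iterate _ hu)).2 _ (Nat.mod_lt _ hr₀))

/-- The periodic points that are not repelling. -/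
def nonRepelling {α : Type*} [TopologicalSpace α] (f : α → α) : Set α :=
  {x ∈ periodicPts f | ¬ IsRepellingPeriodicPt f x}

theorem mem_nonRepelling (hf : Continuous f) {n : ℕ} (hn : 0 < n) {γ : Germ α}
    (hγ : GermValid γ) (hx : f^[n] γ.1 = γ.1)
    (h : ∀ᶠ z in sideNhds γ, SideLT γ.2 γ.1 (f^[n] z) ∧ ¬ SideLT γ.2 z (f^[n] z)) :
    γ.1 ∈ nonRepelling f :=
  ⟨⟨n, hn, hx⟩, not_isRepellingPeriodicPt hf hn hγ hx h⟩

theorem exists_fixed_germ_not_moving_away (hg : Continuous g) {x y : α} (hxy : x < y)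
    (hmono : StrictMonoOn g (Set.Icc x y)) (hx : g x = x) (hy : g y = y) :
    ∃ γ : Germ α, γ.1 ∈ Set.Icc x y ∧ GermValid γ ∧ g γ.1 = γ.1 ∧
      ∀ᶠ z in sideNhds γ, SideLT γ.2 γ.1 (g z) ∧ ¬ SideLT γ.2 z (g z) := by
  by_cases hdown : ∀ z ∈ Set.Ioo x y, g z ≤ z
  · refine ⟨(x, 1), ⟨le_rfl, hxy.le⟩, ⟨y, sideLT_one.2 hxy⟩, hx, ?_⟩
    filter_upwards [eventually_mem_uIoo (γ := (x, 1)) (sideLT_one.2 hxy)] with z hz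
    rw [Set.uIoo_of_lt hxy] at hz
    refine ⟨sideLT_one.2 ?_, fun h => (hdown z hz).not_gt (sideLT_one.1 h)⟩
    simpa only [hx] using hmono ⟨le_rfl, hxy.le⟩ (Set.Ioo_subset_Icc_self hz) hz.1
  push Not at hdown
  obtain ⟨z, hz, hzg⟩ := hdown
  obtain ⟨w, ⟨⟨hzw, hwy⟩, hw⟩, hmin⟩ :=
    (isCompact_Icc.inter_right (isClosed_eq hg continuous_id)).exists_isLeast
      (s := Set.Icc z y ∩ {w | g w = w}) ⟨y, ⟨hz.2.le, le_rfl⟩, hy⟩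
  have hw : g w = w := hw
  have hup : ∀ u ∈ Set.Ico z w, u < g u := fun u hu => not_le.1 fun hgu => by
    obtain ⟨v, hv, hgv⟩ := exists_mem_Icc_isFixedPt hg.continuousOn hu.1 hzg.le hgu
    exact ((hmin ⟨⟨hv.1, hv.2.trans (hu.2.le.trans hwy)⟩, hgv⟩).trans hv.2).not_gt hu.2
  have hzw : z < w := hzw.lt_of_ne (by rintro rfl; exact hzg.ne' hw)
  refine ⟨(w, -1), ⟨hz.1.le.trans hzw.le, hwy⟩, ⟨z, sideLT_neg_one.2 hzw⟩, hw, ?_⟩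
  filter_upwards [eventually_mem_uIoo (γ := (w, -1)) (sideLT_neg_one.2 hzw)] with u hu
  rw [Set.uIoo_of_gt hzw] at hu
  refine ⟨sideLT_neg_one.2 ?_, fun h => (hup u ⟨hu.1.le, hu.2⟩).not_gt (sideLT_neg_one.1 h)⟩
  simpa only [hw] using hmono ⟨hz.1.le.trans hu.1.le, hu.2.le.trans hwy⟩
    ⟨hz.1.le.trans hzw.le, hwy⟩ hu.2

theorem finite_fixedPoints (hf : Continuous f) (hT : (turning f).Finite)
    (hR : (nonRepelling f).Finite) {n : ℕ} (hn : 0 < n) : (fixedPoints f^[n]).Finite := by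
  refine finite_of_forall_lt_inter_Icc_nonempty ((finite_turningIter hf hT n).union hR)
    fun x hx y hy hxy => Set.nonempty_iff_ne_empty.2 fun hempty => ?_
  have hnot : ∀ w ∈ Set.Icc x y, w ∉ turningIter f n ∪ nonRepelling f := fun w hw hw' =>
    Set.notMem_empty w (hempty ▸ ⟨hw', hw⟩)
  have hslope := strictSlopeOn_iterate_of_gap hf n (sideLT_one.2 hxy) fun w hw hwT =>
    hnot w (Set.uIcc_of_le hxy.le ▸ Set.uIoo_subset_uIcc_self hw) (Or.inl hwT)
  have hends := hslope.sideLT_ends (sideLT_one.2 hxy)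
  rw [hx.eq, hy.eq, one_mul] at hends
  rw [hends.unique (sideLT_one.2 hxy), Set.uIcc_of_le hxy.le] at hslope
  have hmono : StrictMonoOn f^[n] (Set.Icc x y) := fun u hu v hv huv =>
    sideLT_one.1 (hslope u hu v hv huv)
  obtain ⟨γ, hγI, hγ, hγf, hev⟩ :=
    exists_fixed_germ_not_moving_away (hf.iterate n) hxy hmono hx hy
  exact hnot γ.1 hγI (Or.inr (mem_nonRepelling hf hn hγ hγf hev))

/-- The germs attracting under some iterate. -/
def attractingGerms {α : Type*} [LinearOrder α] [TopologicalSpace α] (f : α → α) :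
    Set (Germ α) :=
  {γ | ∃ n, 0 < n ∧ IsAttracting f n γ}

theorem finite_attractingGerms (hf : Continuous f) (hR : (nonRepelling f).Finite) :
    (attractingGerms f).Finite := by
  refine (hR.prod (Set.finite_univ (α := ℤˣ))).subset ?_
  rintro γ ⟨n, hn, hγ, hx, hattr⟩
  exact ⟨mem_nonRepelling hf hn hγ hx (hattr.mono fun z hz => ⟨hz.1, hz.2.not_symm⟩),
    Set.mem_univ _⟩

theorem mapsTo_attractingGerms (hf : Continuous f) (hT : (turning f).Finite) :
    Set.MapsTo (germMap f) (attractingGerms f) (attractingGerms f) := by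
  rintro γ ⟨n, hn, hγ, hx, hattr⟩
  have hcomm : ∀ z, f^[n] (f z) = f (f^[n] z) := fun z => (iterate_succ_apply' f n z)
  refine ⟨n, hn, hγ.germMap_iterate hf hT 1, (hcomm γ.1).trans (congrArg f hx), ?_⟩
  have hmap := map_iterate_sideNhds hf hT hγ 1
  rw [iterate_one, iterate_one] at hmap
  rw [← hmap, eventually_map]
  obtain ⟨q, hq⟩ := hγ
  obtain ⟨y, -, hy, hslope⟩ := exists_strictSlopeOn_iterate hf hT 1 hq
  rw [slopeIter_one, iterate_one] at hslope
  filter_upwards [hattr, eventually_mem_uIoo hy] with z hz hzy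
  have hmem : f^[n] z ∈ Set.uIcc γ.1 y :=
    mem_uIcc_of_sideLT hz.1 (hz.2.trans (hy.mem_uIoo_iff.1 hzy).2)
  rw [hcomm]
  exact ⟨hslope.sideLT Set.left_mem_uIcc hmem hz.1,
    hslope.sideLT hmem (Set.uIoo_subset_uIcc_self hzy) hz.2⟩

theorem IsAttracting.germMap_iterate (hf : Continuous f) (hT : (turning f).Finite) {n : ℕ}
    {γ : Germ α} (h : IsAttracting f n γ) : (germMap f)^[n] γ = γ := by
  obtain ⟨hγ, hx, hattr⟩ := h
  have hev := eventually_sideLT_iterate hf hT hγ n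
  have := sideNhds_neBot hγ
  rw [hx] at hev
  obtain ⟨z, hz, hz'⟩ := (hev.and hattr).exists
  rw [IntervalDynamics.germMap_iterate, hx, hz.unique hz'.1]

theorem IsAttracting.of_germMap_iterate (hf : Continuous f) (hT : (turning f).Finite) {m n : ℕ}
    (hfix : (fixedPoints f^[n]).Finite) (hm : 0 < m) (hn : 0 < n) {γ : Germ α}
    (h : IsAttracting f m γ) (hγn : (germMap f)^[n] γ = γ) : IsAttracting f n γ := by
  have hγm := h.germMap_iterate hf hT
  obtain ⟨hγ, -, hattr⟩ := h
  have htendsto : ∀ k, (germMap f)^[k] γ = γ → Tendsto f^[k] (sideNhds γ) (sideNhds γ) :=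
    fun k hk => (map_iterate_sideNhds hf hT hγ k).trans_le (congrArg sideNhds hk).le
  have hγn' := hγn
  rw [IntervalDynamics.germMap_iterate] at hγn'
  have hx : f^[n] γ.1 = γ.1 := congrArg Prod.fst hγn'
  have hs : slopeIter f n γ = 1 := mul_eq_left.1 (congrArg Prod.snd hγn')
  refine (isAttracting_iff hf hT hfix hγ hx).2 ⟨hs, by_contra fun hne => ?_⟩
  have hsign : displacementSign f^[n] γ = γ.2 :=
    (Int.units_ne_iff_eq_neg.1 hne).trans (neg_neg _)
  have hup := eventually_displacementSign (hf.iterate n) hfix hγ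
  rw [hsign] at hup
  have hdown : ∀ᶠ z in sideNhds γ, SideLT (-γ.2) z (f^[m] z) :=
    hattr.mono fun z hz => sideLT_neg.2 hz.2
  have := sideNhds_neBot hγ
  obtain ⟨z, hz, hz'⟩ := ((eventually_sideLT_iterate_of_tendsto (htendsto n hγn) hup hm).and
    (eventually_sideLT_iterate_of_tendsto (htendsto m hγm) hdown hn)).exists
  rw [← iterate_mul] at hz hz'
  rw [mul_comm] at hz'
  exact hz.not_symm (sideLT_neg.1 hz')

theorem setOf_isAttracting_eq (hf : Continuous f) (hT : (turning f).Finite)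
    (hR : (nonRepelling f).Finite) {n : ℕ} (hn : 0 < n) :
    {γ | IsAttracting f n γ} = attractingGerms f ∩ fixedPoints (germMap f)^[n] := by
  ext γ
  refine ⟨fun h => ⟨⟨n, hn, h⟩, h.germMap_iterate hf hT⟩, ?_⟩
  rintro ⟨⟨m, hm, h⟩, hγn⟩
  exact h.of_germMap_iterate hf hT (finite_fixedPoints hf hT hR hn) hm hn hγn

end Periodic

section ShiftSum

open PowerSeries

variable {R : Type*} [CommRing R]

/-- The `R⟦X⟧`-linear operation sending a sequence `G` of power series to `∑ m, X ^ m * G m`. -/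
noncomputable def shiftSum : (ℕ → R⟦X⟧) →ₗ[R⟦X⟧] R⟦X⟧ where
  toFun G := mk fun n => coeff n (∑ m ∈ Finset.range (n + 1), X ^ m * G m)
  map_add' G H := by
    ext n
    simp only [Pi.add_apply, mul_add, Finset.sum_add_distrib, map_add, coeff_mk]
  map_smul' r G := by
    have truncate {n N : ℕ} (h : n ≤ N) :
        coeff n (∑ m ∈ Finset.range (n + 1), X ^ m * G m) =
          coeff n (∑ m ∈ Finset.range (N + 1), X ^ m * G m) := by
      rw [map_sum, map_sum]
      refine Finset.sum_subset (by simpa using h) fun m _ hm => ?_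
      rw [coeff_X_pow_mul', if_neg (by simpa using hm)]
    ext n
    simp only [coeff_mk, Pi.smul_apply, smul_eq_mul, RingHom.id_apply, mul_left_comm _ r,
      ← Finset.mul_sum, coeff_mul]
    refine Finset.sum_congr rfl fun k hk => ?_
    rw [truncate (Finset.HasAntidiagonal.antidiagonal.snd_le hk)]

theorem coeff_shiftSum (G : ℕ → R⟦X⟧) (n : ℕ) :
    coeff n (shiftSum G) = ∑ m ∈ Finset.range (n + 1), coeff (n - m) (G m) := by
  simp only [shiftSum, LinearMap.coe_mk, AddHom.coe_mk, coeff_mk, map_sum]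
  refine Finset.sum_congr rfl fun m hm => ?_
  rw [coeff_X_pow_mul', if_pos (Finset.mem_range_succ_iff.1 hm)]

theorem shiftSum_C (e : ℕ → R) : (shiftSum fun m => C (e m)) = mk e := by
  ext n
  rw [coeff_shiftSum, coeff_mk, Finset.sum_range_succ, Nat.sub_self, coeff_zero_C,
    add_eq_right]
  refine Finset.sum_eq_zero fun m hm => ?_
  rw [coeff_C, if_neg (Nat.sub_ne_zero_of_lt (Finset.mem_range.1 hm))]

end ShiftSum

section Kneading

open PowerSeries Matrix

variable {α : Type*} [LinearOrder α] [TopologicalSpace α] {f : α → α}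

/-- The itinerary of a germ: the generating functions of its signed positions with respect to the
turning points. -/
noncomputable def itinerary (f : α → α) (γ : Germ α) : turning f → ℚ⟦X⟧ :=
  fun i => mk fun n => signedPosition f i n γ

/-- The generating function of the slopes `slopeIter f (n + 1)` of a germ; `slopeIter f 0 = 1` is
left out. -/
noncomputable def slopeSeries (f : α → α) (γ : Germ α) : ℚ⟦X⟧ :=
  mk fun n => sgn (slopeIter f (n + 1) γ)

/-- The kneading matrix of Milnor and Thurston: the jumps of the itinerary at the turning
points. -/
noncomputable def kneading (f : α → α) : Matrix (turning f) (turning f) ℚ⟦X⟧ :=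
  of fun l => itinerary f (l, 1) - itinerary f (l, -1)

/-- The generating functions of the total position of a germ with respect to the points first
hitting a given turning point at time `j`. -/
noncomputable def hits (f : α → α) (γ : Germ α) : turning f → ℚ⟦X⟧ :=
  fun l => mk fun j => ∑ᶠ w ∈ firstHit f j l, position γ w

/-- The jumps of the slope at the turning points, as constant power series. -/
noncomputable def slopeJump (f : α → α) : turning f → ℚ⟦X⟧ :=
  fun i => C (sgn (slope f (i, 1)) - sgn (slope f (i, -1)))

theorem kneading_apply (l i : turning f) :
    kneading f l i = itinerary f (l, 1) i - itinerary f (l, -1) i := rfl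

theorem constantCoeff_kneading [DecidableEq (turning f)] (l i : turning f) :
    constantCoeff (kneading f l i) = (1 : Matrix (turning f) (turning f) ℚ) l i := by
  have hcoeff (s : ℤˣ) : constantCoeff (itinerary f (l, s) i) = position ((l : α), s) i := by
    simp [itinerary, signedPosition, slopeIter_zero, ← coeff_zero_eq_constantCoeff_apply]
  rw [kneading_apply, map_sub, hcoeff, hcoeff, Matrix.one_apply]
  split_ifs with h
  · rw [h, position_right_sub_left]
  · rw [position_right_eq_left (Subtype.coe_injective.ne h), sub_self]

theorem constantCoeff_det_kneading [Fintype (turning f)] [DecidableEq (turning f)] :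
    constantCoeff (kneading f).det = 1 := by
  rw [RingHom.map_det]
  have : constantCoeff.mapMatrix (kneading f) = 1 := by
    ext l i
    exact constantCoeff_kneading l i
  rw [this, det_one]

theorem shiftSum_itinerary (γ : Germ α) (i : turning f) :
    (shiftSum fun m =>
        C (sgn (slopeIter f (m + 1) γ)) * itinerary f ((germMap f)^[m + 1] γ) i) =
      d⁄dX ℚ (itinerary f γ i) := by
  ext n
  have hterm : ∀ m ∈ Finset.range (n + 1), coeff (n - m)
      (C (sgn (slopeIter f (m + 1) γ)) * itinerary f ((germMap f)^[m + 1] γ) i) =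
        signedPosition f i (n + 1) γ := by
    intro m hm
    have hmn : n - m + (m + 1) = n + 1 := by have := Finset.mem_range.1 hm; omega
    rw [coeff_C_mul, itinerary, coeff_mk, signedPosition, signedPosition, ← mul_assoc, ← map_mul,
      ← iterate_add_apply, ← hmn, add_comm (n - m) (m + 1), slopeIter_add f (m + 1),
      add_comm (m + 1)]
  rw [coeff_shiftSum, Finset.sum_congr rfl hterm, coeff_derivative, itinerary, coeff_mk]
  simp [mul_comm]

/-- The average of the itineraries of the two end points. -/
noncomputable def endItinerary [BoundedOrder α] (f : α → α) : turning f → ℚ⟦X⟧ :=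
  C (1 / 2 : ℚ) • (itinerary f (⊥, 1) + itinerary f (⊤, -1))

/-- The average of the slopes at the two end points. -/
noncomputable def endSlope [BoundedOrder α] (f : α → α) : ℚ :=
  (sgn (slope f (⊥, 1)) + sgn (slope f (⊤, -1))) / 2

end Kneading

section KneadingIdentities

open PowerSeries Matrix

variable {α : Type*} [ConditionallyCompleteLinearOrder α] [DenselyOrdered α] [TopologicalSpace α]
  [OrderTopology α] {f : α → α}

theorem gapConst_signedPosition (hf : Continuous f) {i : α} (hi : i ∈ turning f) (n : ℕ) :
    GapConst (signedPosition f i n) (turningIter f (n + 1)) := by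
  intro x y hxy h
  have hn : ∀ w ∈ Set.Ioo x y, w ∉ turningIter f n := fun w hw ⟨j, hj, hw'⟩ =>
    h w hw ⟨j, hj.trans n.lt_succ_self, hw'⟩
  have hmono := strictSlopeOn_iterate_of_gap hf n (sideLT_one.2 hxy)
    (Set.uIoo_of_le hxy.le ▸ hn)
  rw [signedPosition, signedPosition, ← slopeIter_eq_of_gap hf n hxy hn, germMap_iterate,
    germMap_iterate, ← slopeIter_eq_of_gap hf n hxy hn, neg_one_mul, one_mul]
  congr 1
  refine position_eq_of_notMem_uIoo ?_ fun hmem => ?_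
  · simpa using hmono.sideLT Set.left_mem_uIcc Set.right_mem_uIcc (sideLT_one.2 hxy)
  · obtain ⟨w, hw, rfl⟩ := uIoo_subset_image_uIoo (hf.iterate n) x y hmem
    exact h w (Set.uIoo_of_le hxy.le ▸ hw) ⟨n, n.lt_succ_self, hi⟩

theorem derivative_kneading (hf : Continuous f) (hT : (turning f).Finite) (l i : turning f) :
    d⁄dX ℚ (kneading f l i) = -2 * d⁄dX ℚ (itinerary f (l, -1) i) := by
  rw [kneading_apply, map_sub]
  ext n
  have h2 : (-2 : ℚ⟦X⟧) = C (-2) := by rw [map_neg, map_ofNat]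
  rw [h2, coeff_C_mul, map_sub, coeff_derivative, coeff_derivative, itinerary, itinerary,
    coeff_mk, coeff_mk]
  have h := signedPosition_neg_of_mem_turning hf hT l.2 i (-1) n.succ_ne_zero
  rw [neg_neg] at h
  rw [h]
  ring

theorem slopeSeries_neg_of_mem_turning (hf : Continuous f) (hT : (turning f).Finite) {l : α}
    (hl : l ∈ turning f) :
    slopeSeries f (l, 1) = -slopeSeries f (l, -1) := by
  ext n
  have h := slopeIter_neg_of_mem_turning hf hT hl (-1) n.succ_ne_zero
  rw [neg_neg] at h
  rw [map_neg, slopeSeries, slopeSeries, coeff_mk, coeff_mk, h, sgn_neg]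

theorem mk_critSum_eq_sum_shiftSum [Fintype (turning f)] (hf : Continuous f) :
    (mk fun n => critSum f (n + 1)) = ∑ l : turning f, shiftSum fun m =>
      C (sgn (slopeIter f (m + 1) (l, -1))) * hits f ((germMap f)^[m + 1] (l, -1)) l := by
  have hT := Set.toFinite (turning f)
  ext n
  rw [coeff_mk, critSum, finsum_mem_crit hf, Finset.sum_comm, map_sum]
  refine Finset.sum_congr rfl fun l _ => ?_
  rw [coeff_shiftSum, ← Finset.sum_range_reflect]
  refine Finset.sum_congr rfl fun m hm => ?_
  have hmn : n + 1 - 1 - m + (m + 1) = n + 1 := by have := Finset.mem_range.1 hm; omega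
  rw [coeff_C_mul, hits, coeff_mk, mul_finsum_mem, Nat.add_sub_cancel]
  refine finsum_mem_congr rfl fun w hw => ?_
  rw [Nat.add_sub_cancel] at hmn
  rw [← hmn, signedPosition_eq_of_mem_firstHit hf hT l.2 hw w (-1) m.succ_ne_zero, signedPosition]

variable [BoundedOrder α] [Fintype (turning f)]

theorem itinerary_eq_add_hits_vecMul (hf : Continuous f) {γ : Germ α} (hγ : GermValid γ) :
    itinerary f γ = endItinerary f + hits f γ ᵥ* kneading f := by
  have hT := Set.toFinite (turning f)
  funext i
  ext n
  have hfin := finite_crit hf hT (n + 1)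
  have hgap : GapConst (signedPosition f i n) hfin.toFinset := by
    rw [hfin.coe_toFinset]
    exact (gapConst_signedPosition hf i.2 n).inter_innerPoints
  have hmem : ∀ w ∈ hfin.toFinset, ⊥ < w ∧ w < ⊤ := fun w hw =>
    innerPoints_eq_Ioo.subset (hfin.mem_toFinset.1 hw).2
  have hsum := finsum_mem_crit hf (n + 1) fun w =>
    (signedPosition f i n (w, 1) - signedPosition f i n (w, -1)) * position γ w
  rw [finsum_mem_eq_finite_toFinset_sum _ hfin] at hsum
  have hterm : ∀ j ∈ Finset.range (n + 1), ∀ l : turning f,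
      ∑ᶠ w ∈ firstHit f j l,
        (signedPosition f i n (w, 1) - signedPosition f i n (w, -1)) * position γ w =
      coeff j (hits f γ l) * coeff (n - j) (kneading f l i) := by
    intro j hj l
    have hjn : j + (n - j) = n := by have := Finset.mem_range.1 hj; omega
    rw [hits, coeff_mk, finsum_mem_mul]
    refine finsum_mem_congr rfl fun w hw => ?_
    have := signedPosition_jump_of_mem_firstHit hf hT hw i (n - j)
    rw [hjn] at this
    rw [this, mul_comm, kneading_apply, map_sub, itinerary, itinerary, coeff_mk, coeff_mk]
  have hleft : coeff n (itinerary f γ i) = signedPosition f i n γ := coeff_mk _ _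
  rw [hleft, hgap.eq_add_sum hmem hγ, hsum, Pi.add_apply, map_add]
  congr 1
  · simp only [endItinerary, Pi.smul_apply, Pi.add_apply, smul_eq_mul, coeff_C_mul, map_add,
      itinerary, coeff_mk]
    ring
  · simp only [vecMul, dotProduct, map_sum, coeff_mul,
      Finset.Nat.sum_antidiagonal_eq_sum_range_succ_mk]
    rw [Finset.sum_comm]
    exact Finset.sum_congr rfl fun l _ => Finset.sum_congr rfl fun j hj => hterm j hj l

theorem sgn_slope_eq (hf : Continuous f) {γ : Germ α} (hγ : GermValid γ) :
    sgn (slope f γ) = endSlope f +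
      ∑ i : turning f, (sgn (slope f (i, 1)) - sgn (slope f (i, -1))) * position γ i := by
  have hT := Set.toFinite (turning f)
  have hgap : GapConst (fun γ => sgn (slope f γ)) hT.toFinset := by
    rw [hT.coe_toFinset]
    intro x y hxy h
    have := slopeIter_eq_of_gap hf 1 hxy fun w hw ⟨j, hj, hw'⟩ =>
      h w hw (by rwa [Nat.lt_one_iff.1 hj] at hw')
    rw [slopeIter_one, slopeIter_one] at this
    exact congrArg sgn this
  rw [hgap.eq_add_sum (fun w hw => innerPoints_eq_Ioo.subset (hT.mem_toFinset.1 hw).1) hγ,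
    endSlope, ← Finset.sum_subtype hT.toFinset (fun _ => hT.mem_toFinset)
      fun w => (sgn (slope f (w, 1)) - sgn (slope f (w, -1))) * position γ w]

theorem itinerary_dotProduct_slopeJump (hf : Continuous f) {γ : Germ α} (hγ : GermValid γ) :
    itinerary f γ ⬝ᵥ slopeJump f =
      (1 - C (endSlope f) * X) * slopeSeries f γ - C (endSlope f) := by
  ext n
  have hslope := sgn_slope_eq hf (hγ.germMap_iterate hf (Set.toFinite _) n)
  have hsum : coeff n (itinerary f γ ⬝ᵥ slopeJump f) =
      sgn (slopeIter f (n + 1) γ) - endSlope f * sgn (slopeIter f n γ) := by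
    rw [slopeIter_add, slopeIter_one, map_mul, hslope, mul_add, Finset.mul_sum,
      mul_comm (endSlope f), add_sub_cancel_left, dotProduct, map_sum]
    refine Finset.sum_congr rfl fun i _ => ?_
    rw [slopeJump, coeff_mul_C, itinerary, coeff_mk, signedPosition]
    ring
  rw [hsum, sub_mul, one_mul, mul_assoc, map_sub, map_sub, coeff_C_mul, slopeSeries, coeff_mk]
  cases n with
  | zero => simp [slopeIter_zero]
  | succ n => rw [coeff_succ_X_mul, coeff_mk, coeff_C, if_neg n.succ_ne_zero, sub_zero]

theorem kneading_mulVec_slopeJump (hf : Continuous f) :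
    kneading f *ᵥ slopeJump f =
      (-2 * (1 - C (endSlope f) * X)) • fun l : turning f => slopeSeries f (l, -1) := by
  funext l
  have h : (kneading f *ᵥ slopeJump f) l =
      itinerary f (l, 1) ⬝ᵥ slopeJump f - itinerary f (l, -1) ⬝ᵥ slopeJump f :=
    sub_dotProduct _ _ _
  rw [h, itinerary_dotProduct_slopeJump hf (l.2.1 1), itinerary_dotProduct_slopeJump hf (l.2.1 _),
    slopeSeries_neg_of_mem_turning hf (Set.toFinite _) l.2]
  simp only [Pi.smul_apply, smul_eq_mul]
  ring

theorem endItinerary_dotProduct_slopeJump (hf : Continuous f) (hlt : (⊥ : α) < ⊤) :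
    endItinerary f ⬝ᵥ slopeJump f =
      (1 - C (endSlope f) * X) * (C (1 / 2) * (slopeSeries f (⊥, 1) + slopeSeries f (⊤, -1))) -
        C (endSlope f) := by
  have hhalf : C (1 / 2) * (2 : ℚ⟦X⟧) = 1 := by
    rw [← map_ofNat (C (R := ℚ)) 2, ← map_mul, one_div_mul_cancel two_ne_zero, map_one]
  rw [endItinerary, smul_dotProduct, add_dotProduct, smul_eq_mul,
    itinerary_dotProduct_slopeJump hf ⟨⊤, sideLT_one.2 hlt⟩,
    itinerary_dotProduct_slopeJump hf ⟨⊥, sideLT_neg_one.2 hlt⟩]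
  linear_combination -C (endSlope f) * hhalf

variable [DecidableEq (turning f)] {Q : Matrix (turning f) (turning f) ℚ⟦X⟧}

theorem hits_eq_sub_vecMul (hf : Continuous f) (hQ : kneading f * Q = 1) {γ : Germ α}
    (hγ : GermValid γ) : hits f γ = (itinerary f γ - endItinerary f) ᵥ* Q := by
  rw [itinerary_eq_add_hits_vecMul hf hγ, add_sub_cancel_left, vecMul_vecMul, hQ, vecMul_one]

theorem shiftSum_hits (hf : Continuous f) (hQ : kneading f * Q = 1) {γ : Germ α}
    (hγ : GermValid γ) (l : turning f) :
    (shiftSum fun m => C (sgn (slopeIter f (m + 1) γ)) * hits f ((germMap f)^[m + 1] γ) l) =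
      ∑ i, (d⁄dX ℚ (itinerary f γ i) - slopeSeries f γ * endItinerary f i) * Q i l := by
  have hterm : (fun m =>
      C (sgn (slopeIter f (m + 1) γ)) * hits f ((germMap f)^[m + 1] γ) l) =
      ∑ i, Q i l • ((fun m =>
        C (sgn (slopeIter f (m + 1) γ)) * itinerary f ((germMap f)^[m + 1] γ) i) -
        endItinerary f i • fun m => C (sgn (slopeIter f (m + 1) γ))) := by
    funext m
    rw [hits_eq_sub_vecMul hf hQ (hγ.germMap_iterate hf (Set.toFinite _) (m + 1)), vecMul,
      dotProduct, Finset.mul_sum, Finset.sum_apply]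
    refine Finset.sum_congr rfl fun i _ => ?_
    simp only [Pi.sub_apply, Pi.smul_apply, smul_eq_mul]
    ring
  rw [hterm, map_sum]
  refine Finset.sum_congr rfl fun i _ => ?_
  rw [map_smul, map_sub, map_smul, shiftSum_itinerary, shiftSum_C, smul_eq_mul, smul_eq_mul,
    slopeSeries]
  ring

theorem two_mul_mk_critSum (hf : Continuous f) (hQ : kneading f * Q = 1) :
    (2 * mk fun n => critSum f (n + 1)) = -(Q * (kneading f).map (d⁄dX ℚ)).trace -
      2 * (endItinerary f ⬝ᵥ Q *ᵥ fun l : turning f => slopeSeries f (l, -1)) := by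
  have hl (l : turning f) := shiftSum_hits hf hQ (l.2.1 (-1)) l
  simp only [mk_critSum_eq_sum_shiftSum hf, hl, trace, Matrix.diag_apply, Matrix.mul_apply,
    map_apply, dotProduct, mulVec, derivative_kneading hf (Set.toFinite _), Finset.mul_sum]
  rw [Finset.sum_comm, ← Finset.sum_neg_distrib, ← Finset.sum_sub_distrib]
  refine Finset.sum_congr rfl fun i _ => ?_
  rw [← Finset.sum_neg_distrib, ← Finset.sum_sub_distrib]
  exact Finset.sum_congr rfl fun l _ => by ring

theorem mul_mk_critSum (hf : Continuous f) (hlt : (⊥ : α) < ⊤) (hQ : kneading f * Q = 1) :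
    (1 - C (endSlope f) * X) * (2 * mk fun n => critSum f (n + 1)) =
      (1 - C (endSlope f) * X) * (C (1 / 2) * (slopeSeries f (⊥, 1) + slopeSeries f (⊤, -1)) -
        (Q * (kneading f).map (d⁄dX ℚ)).trace) - C (endSlope f) := by
  have hJ : slopeJump f = (-2 * (1 - C (endSlope f) * X)) •
      Q *ᵥ fun l : turning f => slopeSeries f (l, -1) := by
    rw [← mulVec_smul, ← kneading_mulVec_slopeJump hf, mulVec_mulVec, mul_eq_one_comm.1 hQ,
      one_mulVec]
  have hend := endItinerary_dotProduct_slopeJump hf hlt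
  rw [hJ, dotProduct_smul, smul_eq_mul] at hend
  rw [two_mul_mk_critSum hf hQ]
  linear_combination hend

end KneadingIdentities

section Zeta

open PowerSeries

theorem isolatedFixedPts_eq {β : Type*} [TopologicalSpace β] [T1Space β] {h : β → β} {n : ℕ}
    (hfin : (fixedPoints h^[n]).Finite) : isolatedFixedPts h n = fixedPoints h^[n] := by
  refine Set.Subset.antisymm (fun x hx => hx.1) fun x hx =>
    ⟨hx, (fixedPoints h^[n] \ {x})ᶜ, (hfin.subset Set.sdiff_subset).isClosed.isOpen_compl,
      fun hx' => hx'.2 rfl, fun y hy hfix => ?_⟩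
  by_contra hne
  exact hy ⟨hfix, hne⟩

variable {α : Type*} [ConditionallyCompleteLinearOrder α] [DenselyOrdered α] [TopologicalSpace α]
  [OrderTopology α] [BoundedOrder α] {f : α → α}

theorem finite_compl_innerPoints {α : Type*} [LinearOrder α] [BoundedOrder α] :
    (innerPoints α)ᶜ.Finite := by
  refine (Set.toFinite {⊥, ⊤}).subset fun x hx => ?_
  by_contra h
  rw [Set.mem_insert_iff, Set.mem_singleton_iff, not_or] at h
  exact hx (innerPoints_eq_Ioo.superset ⟨bot_lt_iff_ne_bot.2 h.1, lt_top_iff_ne_top.2 h.2⟩)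

theorem mk_ncard_isolatedFixedPts (hf : Continuous f) (hT : (turning f).Finite)
    (hlt : (⊥ : α) < ⊤) (hR : (nonRepelling f).Finite) :
    (mk fun n => ((isolatedFixedPts f (n + 1)).ncard : ℚ)) =
      (mk fun n => ((periodicPtsThrough f (turning f ∪ (innerPoints α)ᶜ) ∩
        fixedPoints f^[n + 1]).ncard : ℚ)) +
      (mk fun n => ((attractingGerms f ∩ fixedPoints (germMap f)^[n + 1]).ncard : ℚ)) +
      C 2 * (mk fun n => critSum f (n + 1)) -
      C (1 / 2) * (slopeSeries f (⊥, 1) + slopeSeries f (⊤, -1)) := by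
  ext n
  have hfix := finite_fixedPoints hf hT hR n.succ_pos
  simp only [map_add, map_sub, coeff_C_mul, coeff_mk, slopeSeries]
  rw [isolatedFixedPts_eq hfix, ncard_fixedPoints hf hT hlt hfix, lapEndFixedPts_eq n.succ_pos,
    setOf_isAttracting_eq hf hT hR n.succ_pos]
  ring

variable [Fintype (turning f)] [DecidableEq (turning f)]

theorem exists_artinMazurZeta_mul_det (hf : Continuous f) (hlt : (⊥ : α) < ⊤)
    (hR : (nonRepelling f).Finite) :
    ∃ F : ℚ⟦X⟧, IsRationalSeries F ∧ constantCoeff F = 1 ∧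
      artinMazurZeta f * (kneading f).det * F = 1 - C (endSlope f) * X := by
  have hT := Set.toFinite (turning f)
  obtain ⟨F₁, hF₁, hc₁, hd₁⟩ := exists_isRationalSeries_hasLogDeriv_neg_ncard
    (finite_periodicPtsThrough (h := f) (hT.union finite_compl_innerPoints))
    mapsTo_periodicPtsThrough
  obtain ⟨F₂, hF₂, hc₂, hd₂⟩ := exists_isRationalSeries_hasLogDeriv_neg_ncard
    (finite_attractingGerms hf hR) (mapsTo_attractingGerms hf hT)
  have hQ : kneading f * (kneading f)⁻¹ = 1 := Matrix.mul_nonsing_inv _ <| by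
    rw [isUnit_iff_constantCoeff, constantCoeff_det_kneading]
    exact isUnit_one
  refine ⟨F₁ * F₂, rationalSeries.mul_mem hF₁ hF₂, by rw [map_mul, hc₁, hc₂, one_mul],
    (((hasLogDeriv_artinMazurZeta f).mul (hasLogDeriv_det hQ)).mul (hd₁.mul hd₂)).unique
      ?_ ?_ ?_⟩
  · have hcount := mk_ncard_isolatedFixedPts hf hT hlt hR
    have hcrit := mul_mk_critSum hf hlt hQ
    have hderiv : d⁄dX ℚ (1 - C (endSlope f) * X) = -C (endSlope f) := by
      simp [Derivation.leibniz]
    rw [HasLogDeriv, hderiv, hcount, map_ofNat]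
    linear_combination -X * hcrit
  · simp [hc₁, hc₂, constantCoeff_det_kneading, constantCoeff_artinMazurZeta]
  · simp

end Zeta

section Determinants

open Matrix

variable {n R : Type*} [Fintype n] [DecidableEq n] [CommRing R]

theorem det_updateCol_mulVec (A : Matrix n n R) (v : n → R) (c : n) :
    (A.updateCol c (A *ᵥ v)).det = v c * A.det := by
  rw [← cramer_apply, cramer_eq_adjugate_mulVec, mulVec_mulVec, adjugate_mul, smul_mulVec,
    one_mulVec, Pi.smul_apply, smul_eq_mul, mul_comm]

theorem det_updateCol_of_row_eq_zero (A : Matrix n n R) {c : n} (hA : ∀ i, i ≠ c → A c i = 0)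
    (b : n → R) : (A.updateCol c b).det = b c * (A.updateCol c (Pi.single c 1)).det := by
  have hzero : (A.updateCol c (b - b c • Pi.single c 1)).det = 0 := by
    refine det_eq_zero_of_row_eq_zero c fun i => ?_
    rcases eq_or_ne i c with rfl | hi
    · simp
    · rw [updateCol_ne hi, hA i hi]
  rw [← sub_add_cancel b (b c • Pi.single c 1), det_updateCol_add, hzero, zero_add,
    det_updateCol_smul]
  simp

theorem det_eq_of_forall_col_eq_smul_add_const {A B : Matrix n n R} (v : n → R) (c : n)
    (hv : v c = 0) (h : ∀ i j, A i j = B i j + v j * B i c) : A.det = B.det := by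
  rw [← det_transpose A, ← det_transpose B]
  exact det_eq_of_forall_row_eq_smul_add_const v c hv fun i j => h j i

end Determinants

section UnimodalCore

open PowerSeries Matrix

variable {α : Type*} [LinearOrder α] [TopologicalSpace α] {f : α → α} {p q c : α}

/-- `f` maps `[p, q]` to itself, `c` is its only turning point inside, and the turning points are
eventually mapped to `[p, q]`. For a virtually unimodal map with dominant turning point `c`,
`[p, q]` is the interval `⟨f²(c), f(c)⟩`. -/
structure IsUnimodalCore (f : α → α) (p q c : α) : Prop where
  continuous : Continuous f
  finite : (turning f).Finite
  mapsTo : Set.MapsTo f (Set.Icc p q) (Set.Icc p q)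
  mem_turning : c ∈ turning f
  mem_Ioo : c ∈ Set.Ioo p q
  unique : ∀ x ∈ turning f, x ∈ Set.Ioo p q → x = c
  exists_iterate : ∃ k, ∀ x ∈ turning f, f^[k] x ∈ Set.Icc p q

open Classical in
/-- The common position with respect to `i` of the germs of `[p, q]`, for `i` outside the
interior of `[p, q]`. -/
noncomputable def corePosition {α : Type*} [LinearOrder α] (p i : α) : ℚ :=
  if i ≤ p then 1 / 2 else -1 / 2

/-- The kneading matrix with multiples of the column `X * slopeSeries f (·, -1)` added to its
columns, so as to replace the position with respect to `i` by its difference with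
`corePosition p i`. -/
noncomputable def reducedKneading (f : α → α) (p : α) : Matrix (turning f) (turning f) ℚ⟦X⟧ :=
  of fun l i => kneading f l i + C (2 * corePosition p (i : α)) * X * slopeSeries f (l, -1)

theorem position_eq_corePosition {α : Type*} [LinearOrder α] {p q i : α}
    (hi : i ∉ Set.Ioo p q) {γ : Germ α} (hγ : GermIn (Set.Icc p q) γ) :
    position γ i = corePosition p i := by
  obtain ⟨⟨hpγ, hγq⟩, y, hy, hγy⟩ := hγ
  by_cases hip : i ≤ p
  · have hright : i < γ.1 ∨ i = γ.1 ∧ γ.2 = 1 := (hip.trans hpγ).lt_or_eq.imp_right fun h =>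
      ⟨h, hγy.elim And.left fun hs => absurd (hs.2.trans_eq h.symm) (hip.trans hy.1).not_gt⟩
    rw [position, corePosition, if_pos hright, if_pos hip]
  · have hqi : q ≤ i := not_lt.1 fun h => hi ⟨not_le.1 hip, h⟩
    have hleft : ¬ (i < γ.1 ∨ i = γ.1 ∧ γ.2 = 1) := by
      rintro (h | ⟨h, hs⟩)
      · exact (hγq.trans hqi).not_gt h
      · rw [hs, sideLT_one, ← h] at hγy
        exact (hy.2.trans hqi).not_gt hγy
    rw [position, corePosition, if_neg hleft, if_neg hip]

theorem eq_of_not_germIn {α : Type*} [LinearOrder α] {p q : α} {γ : Germ α}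
    (hγ : γ.1 ∈ Set.Icc p q) (h : ¬ GermIn (Set.Icc p q) γ) : γ = (p, -1) ∨ γ = (q, 1) := by
  obtain ⟨x, s⟩ := γ
  have hpq : p ≤ q := hγ.1.trans hγ.2
  rcases Int.units_eq_one_or s with rfl | rfl
  · refine .inr (Prod.ext (hγ.2.antisymm (not_lt.1 fun hlt => h ?_)) rfl)
    exact ⟨hγ, q, Set.right_mem_Icc.2 hpq, sideLT_one.2 hlt⟩
  · refine .inl (Prod.ext (le_antisymm (not_lt.1 fun hlt => h ?_) hγ.1) rfl)
    exact ⟨hγ, p, Set.left_mem_Icc.2 hpq, sideLT_neg_one.2 hlt⟩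

theorem constantCoeff_reducedKneading [DecidableEq (turning f)] (l i : turning f) :
    constantCoeff (reducedKneading f p l i) =
      (1 : Matrix (turning f) (turning f) ℚ) l i := by
  rw [reducedKneading, of_apply, map_add, constantCoeff_kneading]
  simp

theorem IsUnimodalCore.notMem_Ioo (h : IsUnimodalCore f p q c) {i : α} (hi : i ∈ turning f)
    (hic : i ≠ c) : i ∉ Set.Ioo p q :=
  fun h' => hic (h.unique i hi h')

theorem IsUnimodalCore.eventuallyPeriodic_germMap_iterate (h : IsUnimodalCore f p q c)
    (l : turning f) (hl : ∀ m, ¬ GermIn (Set.Icc p q) ((germMap f)^[m] (l, -1))) :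
    EventuallyPeriodic fun m => (germMap f)^[m] ((l : α), -1) := by
  obtain ⟨k, hk⟩ := h.exists_iterate
  refine eventuallyPeriodic_iterate (Set.toFinite {(p, -1), (q, 1)}) ?_
  filter_upwards [eventually_ge_atTop k] with m hm
  refine eq_of_not_germIn ?_ (hl m)
  rw [germMap_iterate, ← Nat.sub_add_cancel hm, iterate_add_apply]
  exact h.mapsTo.iterate (m - k) (hk l l.2)

end UnimodalCore

section UnimodalDeterminant

open PowerSeries Matrix

variable {α : Type*} [ConditionallyCompleteLinearOrder α] [DenselyOrdered α] [TopologicalSpace α]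
  [OrderTopology α] {f : α → α} {p q c : α}

theorem coeff_succ_reducedKneading (hf : Continuous f) (hT : (turning f).Finite)
    (l i : turning f) (m : ℕ) :
    coeff (m + 1) (reducedKneading f p l i) = 2 * sgn ((germMap f)^[m + 1] (l, -1)).2 *
      (position ((germMap f)^[m + 1] (l, -1)) i - corePosition p (i : α)) := by
  have hside : sgn ((germMap f)^[m + 1] ((l : α), -1)).2 = -sgn (slopeIter f (m + 1) (l, -1)) := by
    rw [germMap_iterate, neg_one_mul, sgn_neg]
  have hneg := signedPosition_neg_of_mem_turning hf hT l.2 i (-1) m.succ_ne_zero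
  rw [neg_neg] at hneg
  rw [reducedKneading, of_apply, map_add, mul_assoc, coeff_C_mul, coeff_succ_X_mul, slopeSeries,
    coeff_mk, kneading_apply, map_sub, itinerary, itinerary, coeff_mk, coeff_mk, hneg,
    signedPosition, hside]
  ring

namespace IsUnimodalCore

theorem germIn_iterate (h : IsUnimodalCore f p q c) (s : ℤˣ) (m : ℕ) :
    GermIn (Set.Icc p q) ((germMap f)^[m] (c, s)) :=
  (germIn_Icc_of_mem_Ioo h.mem_Ioo s).germMap_iterate h.continuous h.finite h.mapsTo m

theorem coeff_succ_reducedKneading_eq_zero (h : IsUnimodalCore f p q c) (l : turning f)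
    {i : turning f} (hi : (i : α) ≠ c) {m : ℕ}
    (hm : GermIn (Set.Icc p q) ((germMap f)^[m + 1] (l, -1))) :
    coeff (m + 1) (reducedKneading f p l i) = 0 := by
  rw [coeff_succ_reducedKneading h.continuous h.finite,
    position_eq_corePosition (h.notMem_Ioo i.2 hi) hm, sub_self, mul_zero]

theorem reducedKneading_eq_zero (h : IsUnimodalCore f p q c) {l i : turning f}
    (hl : (l : α) = c) (hi : (i : α) ≠ c) : reducedKneading f p l i = 0 := by
  classical
  ext m
  cases m with
  | zero =>
    rw [coeff_zero_eq_constantCoeff_apply, constantCoeff_reducedKneading,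
      one_apply_ne (by rintro rfl; exact hi hl), map_zero]
  | succ m => exact h.coeff_succ_reducedKneading_eq_zero l hi (hl ▸ h.germIn_iterate (-1) _)

theorem isRationalSeries_reducedKneading (h : IsUnimodalCore f p q c) (l : turning f)
    {i : turning f} (hi : (i : α) ≠ c) : IsRationalSeries (reducedKneading f p l i) := by
  by_cases hl : ∃ k, GermIn (Set.Icc p q) ((germMap f)^[k] (l, -1))
  · obtain ⟨k, hk⟩ := hl
    refine isRationalSeries_of_coeff_eq_zero (k + 1) fun m hm => ?_
    obtain ⟨j, rfl⟩ := Nat.exists_eq_add_of_le hm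
    rw [add_right_comm]
    refine h.coeff_succ_reducedKneading_eq_zero l hi ?_
    rw [add_assoc, add_comm, iterate_add_apply]
    exact hk.germMap_iterate h.continuous h.finite h.mapsTo _
  · push Not at hl
    have hmk : reducedKneading f p l i =
        PowerSeries.mk fun m => coeff m (reducedKneading f p l i) := by
      ext m
      rw [coeff_mk]
    rw [hmk]
    refine EventuallyPeriodic.isRationalSeries (((h.eventuallyPeriodic_germMap_iterate l hl).comp
      fun γ => 2 * sgn γ.2 * (position γ i - corePosition p (i : α))).congr ?_)
    filter_upwards [eventually_ge_atTop 1] with m hm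
    obtain ⟨m, rfl⟩ := Nat.exists_eq_add_of_le' hm
    exact coeff_succ_reducedKneading h.continuous h.finite l i m

variable [Fintype (turning f)] [DecidableEq (turning f)]

theorem isRationalSeries_det_updateCol (h : IsUnimodalCore f p q c) {l : turning f}
    (hl : (l : α) = c) :
    IsRationalSeries ((reducedKneading f p).updateCol l (Pi.single l 1)).det := by
  refine det_mem_subring rationalSeries _ fun k i => ?_
  rcases eq_or_ne i l with rfl | hi
  · rw [updateCol_self, Pi.single_apply]
    split_ifs
    exacts [one_mem _, zero_mem _]
  · rw [updateCol_ne hi]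
    exact h.isRationalSeries_reducedKneading k fun hic => hi (Subtype.ext (hic.trans hl.symm))

theorem det_kneading_eq [BoundedOrder α] (h : IsUnimodalCore f p q c) {l : turning f}
    (hl : (l : α) = c) :
    (kneading f).det = slopeSeries f (c, -1) * (C (sgn (slope f (c, -1))) *
      (1 - C (endSlope f) * X) * ((reducedKneading f p).updateCol l (Pi.single l 1)).det) := by
  set S : turning f → ℚ⟦X⟧ := fun k => slopeSeries f (k, -1) with hS
  have hreduce : ((reducedKneading f p).updateCol l S).det = ((kneading f).updateCol l S).det := by
    refine det_eq_of_forall_col_eq_smul_add_const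
      (fun i => if i = l then 0 else C (2 * corePosition p (i : α)) * X) l (if_pos rfl)
      fun k i => ?_
    rcases eq_or_ne i l with rfl | hi
    · simp
    · rw [updateCol_ne hi, updateCol_ne hi, updateCol_self, if_neg hi]
      rfl
  have hexpand := det_updateCol_of_row_eq_zero (reducedKneading f p) (c := l)
    (fun i hi => h.reducedKneading_eq_zero hl fun hic => hi (Subtype.ext (hic.trans hl.symm))) S
  have hcramer := det_updateCol_mulVec (kneading f) (slopeJump f) l
  have hjump : slopeJump f l = -2 * C (sgn (slope f (c, -1))) := by
    have hneg := slope_neg_of_mem_turning h.continuous h.finite h.mem_turning (-1)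
    rw [neg_neg] at hneg
    rw [slopeJump, hl, hneg, sgn_neg, map_sub, map_neg]
    ring
  rw [kneading_mulVec_slopeJump h.continuous, ← hS, det_updateCol_smul, ← hreduce, hexpand,
    hjump] at hcramer
  have hsgn : C (sgn (slope f (c, -1))) * C (sgn (slope f (c, -1))) = (1 : ℚ⟦X⟧) := by
    rw [← map_mul, sgn_mul_self, map_one]
  have hSl : S l = slopeSeries f (c, -1) := congrArg (fun x => slopeSeries f (x, -1)) hl
  rw [hSl] at hcramer
  have htwo : (2 : ℚ⟦X⟧) ≠ 0 := fun h₂ =>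
    two_ne_zero (α := ℚ) (by rw [← map_ofNat (constantCoeff (R := ℚ)) 2, h₂, map_zero])
  refine mul_left_cancel₀ htwo ?_
  linear_combination C (sgn (slope f (c, -1))) * hcramer - 2 * (kneading f).det * hsgn

theorem isRationalSeries_det_kneading_iff [BoundedOrder α] (h : IsUnimodalCore f p q c) :
    IsRationalSeries (kneading f).det ↔ IsRationalSeries (slopeSeries f (c, -1)) := by
  have hdet := h.det_kneading_eq (l := ⟨c, h.mem_turning⟩) rfl
  set H := C (sgn (slope f (c, -1))) * (1 - C (endSlope f) * X) *
    ((reducedKneading f p).updateCol ⟨c, h.mem_turning⟩ (Pi.single ⟨c, h.mem_turning⟩ 1)).det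
  have hH : H ∈ rationalSeries := mul_mem (mul_mem (C_mem_rationalSeries _) (sub_mem (one_mem _)
    (mul_mem (C_mem_rationalSeries _) X_mem_rationalSeries)))
    (h.isRationalSeries_det_updateCol rfl)
  have hH₀ : H ≠ 0 := by
    intro h₀
    have := constantCoeff_det_kneading (f := f)
    rw [hdet, h₀, mul_zero, map_zero] at this
    exact zero_ne_one this
  exact ⟨fun hK => .of_mul_right hH hH₀ (hdet ▸ hK), fun hS => hdet ▸ mul_mem hS hH⟩

end IsUnimodalCore

end UnimodalDeterminant

section AsymptoticallyPeriodic

variable {X : Type*} [TopologicalSpace X] {f : X → X}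

theorem isAsymptoticToPeriodicOrbit_of_mem_periodicPts {y : X} (hy : y ∈ periodicPts f) :
    IsAsymptoticToPeriodicOrbit f y :=
  ⟨y, hy, 0, tendsto_const_nhds.congr fun k =>
    ((isPeriodicPt_minimalPeriod f y).const_mul k).eq.symm⟩

theorem IsAsymptoticToPeriodicOrbit.of_iterate {y : X} {M : ℕ}
    (h : IsAsymptoticToPeriodicOrbit f (f^[M] y)) : IsAsymptoticToPeriodicOrbit f y := by
  obtain ⟨x, hx, m, hlim⟩ := h
  exact ⟨x, hx, m + M, by simpa only [← iterate_add_apply, add_assoc] using hlim⟩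

theorem eventually_of_forall_mod {P : ℕ → Prop} {r : ℕ} (hr : 0 < r)
    (h : ∀ i < r, ∀ᶠ j in atTop, P (j * r + i)) : ∀ᶠ n in atTop, P n := by
  have hall : ∀ᶠ j in atTop, ∀ i ∈ Set.Iio r, P (j * r + i) :=
    (eventually_all_finite (Set.finite_Iio r)).2 h
  filter_upwards [(Nat.tendsto_div_const_atTop hr.ne').eventually hall] with n hn
  simpa only [Nat.div_add_mod'] using hn (n % r) (Nat.mod_lt n hr)

theorem isAsymptoticToPeriodicOrbit_of_tendsto [T2Space X] (hf : Continuous f) {P : ℕ} (hP : 0 < P)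
    {y z : X} (h : Tendsto (fun k => f^[k * P] y) atTop (𝓝 z)) :
    IsAsymptoticToPeriodicOrbit f y := by
  have hlim (i : ℕ) : Tendsto (fun k => f^[k * P + i] y) atTop (𝓝 (f^[i] z)) := by
    simpa only [add_comm _ i, iterate_add_apply, comp_def] using ((hf.iterate i).tendsto z).comp h
  have hper : IsPeriodicPt f P z := by
    refine tendsto_nhds_unique (hlim P) ?_
    simpa only [add_mul, one_mul] using (tendsto_add_atTop_iff_nat 1).2 h
  refine ⟨z, ⟨P, hP, hper⟩, 0, ?_⟩
  obtain ⟨r, hr⟩ := hper.minimalPeriod_dvd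
  refine fun U hU => eventually_of_forall_mod (r := r) (Nat.pos_of_mul_pos_left (hr ▸ hP))
    fun i _ => ?_
  have hi := hlim (i * minimalPeriod f z)
  rw [((isPeriodicPt_minimalPeriod f z).const_mul i).eq] at hi
  filter_upwards [hi hU] with k hk
  rwa [add_zero, add_mul, mul_assoc, mul_comm r, ← hr]

end AsymptoticallyPeriodic

section SlopeSequence

open PowerSeries

variable {α : Type*} [LinearOrder α] {f : α → α} {γ : Germ α}

theorem EventuallyPeriodic.slopeIter_of_slope
    (h : EventuallyPeriodic fun m => slope f ((germMap f)^[m] γ)) :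
    EventuallyPeriodic fun m => slopeIter f m γ := by
  obtain ⟨M, P, hP, hM⟩ := h
  -- The increment of `slopeIter` over one period is constant; as it is `±1`, the increment over
  -- two periods is `1`.
  have hincr : ∀ m, M ≤ m →
      slopeIter f P ((germMap f)^[m + P] γ) = slopeIter f P ((germMap f)^[m] γ) := by
    refine fun m hm => Finset.prod_congr rfl fun i _ => ?_
    rw [← iterate_add_apply, ← iterate_add_apply, ← add_assoc]
    exact hM (i + m) (le_add_left hm)
  refine ⟨M, P + P, add_pos hP hP, fun m hm => ?_⟩
  simp only [← add_assoc]
  rw [slopeIter_add, slopeIter_add, hincr m hm, mul_assoc, Int.units_mul_self,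
    mul_one]

theorem eventuallyPeriodic_slopeIter_of_mem_periodicPts (h : γ.1 ∈ periodicPts f) :
    EventuallyPeriodic fun m => slopeIter f m γ := by
  obtain ⟨P, hP, hper⟩ := h
  have hgerm : EventuallyPeriodic fun m => (germMap f)^[m] γ := by
    refine eventuallyPeriodic_iterate
      (((Set.finite_Iio P).image (f^[·] γ.1)).prod (Set.finite_univ (α := ℤˣ)))
      (.of_forall fun m => ⟨⟨m % P, Nat.mod_lt m hP, ?_⟩, Set.mem_univ _⟩)
    rw [germMap_iterate]
    exact hper.iterate_mod_apply m
  convert hgerm.comp fun δ => γ.2 * δ.2 using 2 with m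
  rw [germMap_iterate, ← mul_assoc, Int.units_mul_self, one_mul]

theorem slope_germMap_iterate_add {M P : ℕ}
    (h : ∀ m, M ≤ m → slopeIter f (m + P) γ = slopeIter f m γ) {m : ℕ} (hm : M ≤ m) :
    slope f ((germMap f)^[m + P] γ) = slope f ((germMap f)^[m] γ) := by
  have hsucc := h (m + 1) (Nat.le_succ_of_le hm)
  rw [add_right_comm, slopeIter_succ', slopeIter_succ', h m hm] at hsucc
  exact mul_left_cancel hsucc

theorem slopeIter_mul_germMap_iterate {M P : ℕ}
    (h : ∀ m, M ≤ m → slopeIter f (m + P) γ = slopeIter f m γ) (k : ℕ) :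
    slopeIter f (k * P) ((germMap f)^[M] γ) = 1 := by
  induction k with
  | zero => rw [zero_mul, slopeIter_zero]
  | succ k ih =>
    have hk := h (M + k * P) (Nat.le_add_right M _)
    rw [add_assoc, slopeIter_add f M (k * P), slopeIter_add f M (k * P + P), ih, mul_one,
      mul_eq_left] at hk
    rwa [add_mul, one_mul]

theorem isRationalSeries_slopeSeries_iff :
    IsRationalSeries (slopeSeries f γ) ↔ EventuallyPeriodic fun m => slopeIter f m γ := by
  constructor
  · intro h
    have hfin : (Set.range fun m => sgn (slopeIter f (m + 1) γ)).Finite :=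
      (Set.finite_range sgn).subset (Set.range_comp_subset_range _ sgn)
    obtain ⟨M, P, hP, hM⟩ := h.eventuallyPeriodic hfin
    refine ⟨M + 1, P, hP, fun m hm => ?_⟩
    obtain ⟨m, rfl⟩ := Nat.exists_eq_add_of_le' ((Nat.le_add_left 1 M).trans hm)
    rw [add_right_comm]
    exact sgn_injective (hM m (by omega))
  · rintro ⟨M, P, hP, hM⟩
    refine EventuallyPeriodic.isRationalSeries ⟨M, P, hP, fun m hm => congrArg sgn ?_⟩
    rw [add_right_comm]
    exact hM (m + 1) (by omega)

end SlopeSequence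

section UnimodalOrbit

theorem SideLT.eventually {α : Type*} [LinearOrder α] [TopologicalSpace α] [OrderTopology α]
    {s : ℤˣ} {x y : α} (h : SideLT s x y) : ∀ᶠ z in 𝓝 y, SideLT s x z := by
  rcases h with ⟨rfl, h⟩ | ⟨rfl, h⟩
  · simpa only [sideLT_one] using eventually_gt_nhds h
  · simpa only [sideLT_neg_one] using eventually_lt_nhds h

variable {α : Type*} [ConditionallyCompleteLinearOrder α] [TopologicalSpace α]
  [OrderTopology α] {f : α → α} {p q c : α}

theorem exists_tendsto_of_forall_sideLT {s : ℤˣ} {u : ℕ → α} (hu : ∀ k, u k ∈ Set.Icc p q)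
    (h : ∀ k, SideLT s (u k) (u (k + 1))) : ∃ z, Tendsto u atTop (𝓝 z) := by
  rcases Int.units_eq_one_or s with rfl | rfl
  · simp only [sideLT_one] at h
    exact ⟨_, tendsto_atTop_ciSup (strictMono_nat_of_lt_succ h).monotone
      ⟨q, Set.forall_mem_range.2 fun k => (hu k).2⟩⟩
  · simp only [sideLT_neg_one] at h
    exact ⟨_, tendsto_atTop_ciInf (strictAnti_nat_of_succ_lt h).antitone
      ⟨p, Set.forall_mem_range.2 fun k => (hu k).1⟩⟩

variable [DenselyOrdered α]

namespace IsUnimodalCore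

theorem exists_strictSlopeOn (h : IsUnimodalCore f p q c) (s : ℤˣ) :
    ∃ e, StrictSlopeOn f (slope f (c, s)) (Set.uIcc c e) ∧
      ∀ x ∈ Set.Icc p q, SideLT s c x → x ∈ Set.uIcc c e := by
  have ⟨hpc, hcq⟩ := h.mem_Ioo
  rcases Int.units_eq_one_or s with rfl | rfl
  · refine ⟨q, strictSlopeOn_of_gap h.continuous (sideLT_one.2 hcq) fun w hw hwT => ?_,
      fun x hx hcx => Set.mem_uIcc_of_le (sideLT_one.1 hcx).le hx.2⟩
    rw [Set.uIoo_of_lt hcq] at hw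
    exact hw.1.ne' (h.unique w hwT ⟨hpc.trans hw.1, hw.2⟩)
  · refine ⟨p, strictSlopeOn_of_gap h.continuous (sideLT_neg_one.2 hpc) fun w hw hwT => ?_,
      fun x hx hcx => Set.mem_uIcc_of_ge hx.1 (sideLT_neg_one.1 hcx).le⟩
    rw [Set.uIoo_of_gt hpc] at hw
    exact hw.2.ne (h.unique w hwT ⟨hw.1, hw.2.trans hcq⟩)

theorem slope_eq_of_sideLT (h : IsUnimodalCore f p q c) {γ : Germ α}
    (hγ : GermIn (Set.Icc p q) γ) {s : ℤˣ} (hs : SideLT s c γ.1) :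
    slope f γ = slope f (c, s) := by
  obtain ⟨e, he, hmem⟩ := h.exists_strictSlopeOn s
  obtain ⟨x, t⟩ := γ
  obtain ⟨hx, y, hy, hxy⟩ := hγ
  obtain rfl | rfl : t = s ∨ t = -s := (eq_or_ne t s).imp_right Int.units_ne_iff_eq_neg.1
  · exact (he.mono (Set.uIcc_subset_uIcc (hmem x hx hs) (hmem y hy (hs.trans hxy)))).slope_eq hxy
  · exact (he.mono (Set.uIcc_subset_uIcc (hmem x hx hs) Set.left_mem_uIcc)).slope_eq
      (sideLT_neg.2 hs)

theorem slope_eq_iff (h : IsUnimodalCore f p q c) {γ δ : Germ α}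
    (hγ : GermIn (Set.Icc p q) γ) (hδ : GermIn (Set.Icc p q) δ) {s t : ℤˣ}
    (hs : SideLT s c γ.1) (ht : SideLT t c δ.1) : slope f γ = slope f δ ↔ s = t := by
  rw [h.slope_eq_of_sideLT hγ hs, h.slope_eq_of_sideLT hδ ht]
  refine ⟨fun heq => ?_, fun hst => hst ▸ rfl⟩
  by_contra hst
  rw [Int.units_ne_iff_eq_neg.1 hst,
    slope_neg_of_mem_turning h.continuous h.finite h.mem_turning] at heq
  exact units_ne_neg_self _ heq.symm

theorem sideLT_of_slope_eq (h : IsUnimodalCore f p q c) {γ δ : Germ α}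
    (hγ : GermIn (Set.Icc p q) γ) (hδ : GermIn (Set.Icc p q) δ) (hγc : γ.1 ≠ c) (hδc : δ.1 ≠ c)
    (hslope : slope f γ = slope f δ) {s : ℤˣ} (hs : SideLT s γ.1 δ.1) :
    SideLT (s * slope f γ) (f γ.1) (f δ.1) := by
  obtain ⟨t, ht⟩ := exists_sideLT_of_ne hγc.symm
  obtain ⟨t', ht'⟩ := exists_sideLT_of_ne hδc.symm
  obtain rfl := (h.slope_eq_iff hγ hδ ht ht').1 hslope
  obtain ⟨e, he, hmem⟩ := h.exists_strictSlopeOn t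
  rw [h.slope_eq_of_sideLT hγ ht]
  exact he.sideLT (hmem γ.1 hγ.1 ht) (hmem δ.1 hδ.1 ht') hs

theorem sideLT_iterate (h : IsUnimodalCore f p q c) {γ δ : Germ α}
    (hγ : GermIn (Set.Icc p q) γ) (hδ : GermIn (Set.Icc p q) δ) (hγc : ∀ i, f^[i] γ.1 ≠ c)
    (hδc : ∀ i, f^[i] δ.1 ≠ c)
    (hslope : ∀ i, slope f ((germMap f)^[i] γ) = slope f ((germMap f)^[i] δ)) {s : ℤˣ}
    (hs : SideLT s γ.1 δ.1) (i : ℕ) : SideLT (s * slopeIter f i γ) (f^[i] γ.1) (f^[i] δ.1) := by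
  have hfst (i : ℕ) (γ : Germ α) : ((germMap f)^[i] γ).1 = f^[i] γ.1 := by rw [germMap_iterate]
  induction i with
  | zero => simpa using hs
  | succ i ih =>
    rw [slopeIter_succ', ← mul_assoc, iterate_succ_apply', iterate_succ_apply', ← hfst, ← hfst]
    refine h.sideLT_of_slope_eq (hγ.germMap_iterate h.continuous h.finite h.mapsTo i)
      (hδ.germMap_iterate h.continuous h.finite h.mapsTo i) ?_ ?_ (hslope i) ?_ <;>
      simp only [hfst]
    exacts [hγc i, hδc i, ih]

theorem sideLT_iterate_mul (h : IsUnimodalCore f p q c) {M P : ℕ}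
    (hM : ∀ m, M ≤ m → slopeIter f (m + P) (c, -1) = slopeIter f m (c, -1))
    (horbit : ∀ i, f^[i + M] c ≠ c) {s : ℤˣ} (hs : SideLT s (f^[M] c) (f^[P] (f^[M] c))) (k : ℕ) :
    SideLT s (f^[k * P] (f^[M] c)) (f^[(k + 1) * P] (f^[M] c)) := by
  have hfst (m : ℕ) : ((germMap f)^[m] (c, -1)).1 = f^[m] c := by rw [germMap_iterate]
  have hslope (i : ℕ) : slope f ((germMap f)^[i] ((germMap f)^[M] (c, -1))) =
      slope f ((germMap f)^[i] ((germMap f)^[M + P] (c, -1))) := by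
    rw [← iterate_add_apply, ← iterate_add_apply, ← add_assoc]
    exact (slope_germMap_iterate_add hM (Nat.le_add_left M i)).symm
  have hk := h.sideLT_iterate (h.germIn_iterate (-1) M) (h.germIn_iterate (-1) (M + P))
    (fun i => ?_) (fun i => ?_) hslope (s := s) ?_ (k * P)
  · rwa [slopeIter_mul_germMap_iterate hM, mul_one, hfst, hfst, add_comm M,
      iterate_add_apply f P, ← iterate_add_apply f (k * P) P, ← add_one_mul] at hk
  · rw [hfst, ← iterate_add_apply]
    exact horbit i
  · rw [hfst, ← iterate_add_apply, add_comm M, ← add_assoc]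
    exact horbit (i + P)
  · rwa [hfst, hfst, add_comm, iterate_add_apply]

theorem isAsymptoticToPeriodicOrbit (h : IsUnimodalCore f p q c)
    (he : EventuallyPeriodic fun m => slopeIter f m (c, -1)) :
    IsAsymptoticToPeriodicOrbit f c := by
  by_cases hc : c ∈ periodicPts f
  · exact isAsymptoticToPeriodicOrbit_of_mem_periodicPts hc
  obtain ⟨M, P, hP, hM⟩ := he
  refine .of_iterate (M := M + 1) ?_
  by_cases hfix : f^[P] (f^[M + 1] c) = f^[M + 1] c
  · exact isAsymptoticToPeriodicOrbit_of_mem_periodicPts ⟨P, hP, hfix⟩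
  obtain ⟨s, hs⟩ := exists_sideLT_of_ne (Ne.symm hfix)
  have hmono := h.sideLT_iterate_mul (fun m hm => hM m (Nat.le_of_succ_le hm))
    (fun i h₀ => hc ⟨i + (M + 1), Nat.succ_pos _, h₀⟩) hs
  obtain ⟨z, hz⟩ := exists_tendsto_of_forall_sideLT (p := p) (q := q) (fun k => by
    rw [← iterate_add_apply]
    exact h.mapsTo.iterate _ (Set.Ioo_subset_Icc_self h.mem_Ioo)) hmono
  exact isAsymptoticToPeriodicOrbit_of_tendsto h.continuous hP hz

theorem eventuallyPeriodic_slopeIter (h : IsUnimodalCore f p q c)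
    (ha : IsAsymptoticToPeriodicOrbit f c) :
    EventuallyPeriodic fun m => slopeIter f m (c, -1) := by
  by_cases hc : c ∈ periodicPts f
  · exact eventuallyPeriodic_slopeIter_of_mem_periodicPts hc
  obtain ⟨x, hx, M, hlim⟩ := ha
  set Q := minimalPeriod f x
  have hQ : 0 < Q := minimalPeriod_pos_of_mem_periodicPts hx
  have hside : ∀ᶠ n in atTop, ∃ s, SideLT s c (f^[n] x) ∧ SideLT s c (f^[n + M] c) := by
    refine eventually_of_forall_mod hQ fun i _ => ?_
    have hxc : f^[i] x ≠ c := fun h₀ =>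
      hc ⟨Q, hQ, h₀ ▸ (isPeriodicPt_minimalPeriod f x).apply_iterate i⟩
    obtain ⟨s, hs⟩ := exists_sideLT_of_ne hxc.symm
    have hlim_i := ((h.continuous.iterate i).tendsto x).comp hlim
    filter_upwards [hlim_i.eventually hs.eventually] with j hj
    have hper : f^[j * Q] x = x := ((isPeriodicPt_minimalPeriod f x).const_mul j).eq
    refine ⟨s, ?_, ?_⟩
    · rwa [add_comm, iterate_add_apply, hper]
    · rwa [add_comm _ i, add_assoc, iterate_add_apply]
  obtain ⟨N, hN⟩ := eventually_atTop.1 hside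
  refine .slopeIter_of_slope ⟨N + M, Q, hQ, fun n hn => ?_⟩
  obtain ⟨n, rfl⟩ := Nat.exists_eq_add_of_le' ((Nat.le_add_left M N).trans hn)
  obtain ⟨s, hxs, hs⟩ := hN n (by omega)
  obtain ⟨t, hxt, ht⟩ := hN (n + Q) (by omega)
  rw [iterate_add_apply, iterate_minimalPeriod] at hxt
  rw [add_right_comm] at ht
  refine (h.slope_eq_iff (h.germIn_iterate _ _) (h.germIn_iterate _ _) ?_ ?_).2 (hxt.unique hxs)
  all_goals rwa [germMap_iterate]

open PowerSeries in
theorem isRationalSeries_artinMazurZeta_iff [BoundedOrder α] (h : IsUnimodalCore f p q c)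
    (hR : (nonRepelling f).Finite) :
    IsRationalSeries (artinMazurZeta f) ↔ IsAsymptoticToPeriodicOrbit f c := by
  classical
  have := h.finite.fintype
  have hlt : (⊥ : α) < ⊤ := bot_le.trans_lt (h.mem_Ioo.2.trans_le le_top)
  obtain ⟨F, hF, hF₁, hprod⟩ := exists_artinMazurZeta_mul_det h.continuous hlt hR
  have hF₀ : F ≠ 0 := fun h₀ => by simp [h₀] at hF₁
  let H := 1 - C (endSlope f) * X
  have hH : IsRationalSeries H :=
    sub_mem (one_mem _) (mul_mem (C_mem_rationalSeries _) X_mem_rationalSeries)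
  have hH₀ : H ≠ 0 := fun h₀ => by simpa [H] using congrArg constantCoeff h₀
  rw [isRationalSeries_iff_of_mul_eq hH hH₀ ((mul_assoc _ _ _).symm.trans hprod),
    show IsRationalSeries ((kneading f).det * F) ↔ IsRationalSeries (kneading f).det from
      ⟨hF.of_mul_right hF₀, fun hdet => rationalSeries.mul_mem hdet hF⟩,
    h.isRationalSeries_det_kneading_iff, isRationalSeries_slopeSeries_iff]
  exact ⟨h.isAsymptoticToPeriodicOrbit, h.eventuallyPeriodic_slopeIter⟩

end IsUnimodalCore

end UnimodalOrbit

section UniqueTurningPoint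

theorem StrictSlopeOn.not_isLocalExtr {α β : Type*} [LinearOrder α] [TopologicalSpace α]
    [OrderTopology α] [DenselyOrdered α] [LinearOrder β] {f : α → β} {η : ℤˣ} {p q x : α}
    (h : StrictSlopeOn f η (Set.Icc p q)) (hx : x ∈ Set.Ioo p q) : ¬ IsLocalExtr f x := by
  have hnear (s : ℤˣ) : ∃ᶠ y in 𝓝 x, SideLT (s * η) (f x) (f y) := by
    have := sideNhds_neBot (germValid_of_mem_Ioo hx s)
    have hside := (eventually_sideLT (x, s)).and
      (sideNhds_le_nhds (x, s) (Ioo_mem_nhds hx.1 hx.2))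
    refine (hside.mono fun y hy => ?_).frequently.filter_mono (sideNhds_le_nhds _)
    exact h.sideLT (Set.Ioo_subset_Icc_self hx) (Set.Ioo_subset_Icc_self hy.2) hy.1
  rintro (hmin | hmax)
  · obtain ⟨y, hy, hle⟩ := ((hnear (-η)).and_eventually hmin).exists
    rw [neg_mul, Int.units_mul_self, sideLT_neg_one] at hy
    exact hy.not_ge hle
  · obtain ⟨y, hy, hle⟩ := ((hnear η).and_eventually hmax).exists
    rw [Int.units_mul_self, sideLT_one] at hy
    exact hy.not_ge hle

theorem exists_mem_Ioo_of_notMem_range {α : Type*} [LinearOrder α] {n : ℕ} {p : Fin (n + 1) → α}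
    {x : α} (hx : x ∉ Set.range p) (h₀ : p 0 < x) (h₁ : x < p (Fin.last n)) :
    ∃ i : Fin n, x ∈ Set.Ioo (p i.castSucc) (p i.succ) := by
  by_contra! hout
  have hlt (j : Fin (n + 1)) : p j < x := by
    induction j using Fin.induction with
    | zero => exact h₀
    | succ i ih =>
      exact (le_of_not_gt fun hi => hout i ⟨ih, hi⟩).lt_of_ne fun he => hx ⟨_, he⟩
  exact (hlt (Fin.last n)).not_gt h₁

theorem mapsTo_uIcc_of_turning_inter_subset {α : Type*} [ConditionallyCompleteLinearOrder α]
    [TopologicalSpace α] [OrderTopology α] [DenselyOrdered α] {f : α → α} (hf : Continuous f)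
    {p q c : α} (hc : c ∈ Set.uIcc p q) (hT : turning f ∩ Set.uIoo p q ⊆ {c})
    (hfp : f p ∈ Set.uIcc p q) (hfq : f q ∈ Set.uIcc p q) (hfc : f c ∈ Set.uIcc p q) :
    Set.MapsTo f (Set.uIcc p q) (Set.uIcc p q) := by
  have hside {e : α} (he : e ∈ Set.uIcc p q) (hfe : f e ∈ Set.uIcc p q) :
      Set.MapsTo f (Set.uIcc c e) (Set.uIcc p q) := by
    obtain ⟨η, hη⟩ := exists_strictSlopeOn_of_gap hf (x := c) (y := e) fun w hw hwT => by
      obtain rfl : w = c :=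
        hT ⟨hwT, (le_inf hc.1 he.1).trans_lt hw.1, hw.2.trans_le (sup_le hc.2 he.2)⟩
      exact Set.left_notMem_uIoo hw
    exact hη.mapsTo_uIcc.mono_right (Set.uIcc_subset_uIcc hfc hfe)
  intro x hx
  rcases Set.uIcc_subset_uIcc_union_uIcc (b := c) hx with hx | hx
  · exact hside Set.left_mem_uIcc hfp (Set.uIcc_comm p c ▸ hx)
  · exact hside Set.right_mem_uIcc hfq hx

end UniqueTurningPoint

section Interval

variable {a b : ℝ} {f : Set.Icc a b → Set.Icc a b} {c : Set.Icc a b}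

theorem turning_eq_turningPoints [Fact (a ≤ b)] : turning f = turningPoints f := by
  ext x
  rw [turning, innerPoints_eq_Ioo]
  exact and_assoc

theorem IsPiecewiseMonotone.finite_turningPoints (hf : IsPiecewiseMonotone f) :
    (turningPoints f).Finite := by
  obtain ⟨m, p, -, hp₀, hp₁, hmono⟩ := hf.exists_subdivision
  refine (Set.finite_range p).subset fun x ⟨hax, hxb, hext⟩ => ?_
  by_contra hx
  obtain ⟨i, hi⟩ := exists_mem_Ioo_of_notMem_range hx (Subtype.coe_lt_coe.1 (hp₀.trans_lt hax))
    (Subtype.coe_lt_coe.1 (hxb.trans_eq hp₁.symm))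
  rcases hmono i with h | h
  · exact (strictSlopeOn_of_strictMonoOn h).not_isLocalExtr hi hext
  · exact (strictSlopeOn_of_strictAntiOn h).not_isLocalExtr hi hext

theorem preimage_interior_uIcc (x y : Set.Icc a b) :
    Subtype.val ⁻¹' interior (Set.uIcc (x : ℝ) y) = Set.uIoo x y := by
  rw [Set.uIcc, interior_Icc]
  rfl

namespace IsVirtuallyUnimodal

theorem turningPoints_inter_uIoo (hf : IsVirtuallyUnimodal f c) :
    turningPoints f ∩ Set.uIoo (f (f c)) (f c) = {c} := by
  refine Subtype.val_injective.image_injective ?_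
  rw [Set.image_singleton, ← hf.turningPoints_inter, ← preimage_interior_uIcc,
    Set.image_inter_preimage]

theorem isUnimodalCore [Fact (a ≤ b)] (hf : IsVirtuallyUnimodal f c) :
    IsUnimodalCore f (f (f c) ⊓ f c) (f (f c) ⊔ f c) c where
  continuous := hf.piecewiseMonotone.continuous
  finite := turning_eq_turningPoints (f := f) ▸ hf.piecewiseMonotone.finite_turningPoints
  mapsTo := by
    let _ : Inhabited (Set.Icc a b) := ⟨c⟩
    refine mapsTo_uIcc_of_turning_inter_subset hf.piecewiseMonotone.continuous
      (hf.orbit_subset 0) ?_ (hf.orbit_subset 3) (hf.orbit_subset 2) (hf.orbit_subset 1)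
    exact turning_eq_turningPoints (f := f) ▸ hf.turningPoints_inter_uIoo.le
  mem_turning := turning_eq_turningPoints (f := f) ▸ hf.mem_turningPoints
  mem_Ioo := (hf.turningPoints_inter_uIoo.ge rfl).2
  unique x hx hx' := hf.turningPoints_inter_uIoo.le ⟨turning_eq_turningPoints (f := f) ▸ hx, hx'⟩
  exists_iterate := by
    rw [turning_eq_turningPoints]
    exact hf.turningPoints_image.imp fun k hk x hx => hk ⟨x, hx, rfl⟩

end IsVirtuallyUnimodal

end Interval

end IntervalDynamics

theorem mainTheorem4 {a b : ℝ} (hab : a < b)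
    (f : Set.Icc a b → Set.Icc a b) (c : Set.Icc a b)
    (hf : IntervalDynamics.IsVirtuallyUnimodal f c)
    (hrep : {x | x ∈ Function.periodicPts f ∧
      ¬ IntervalDynamics.IsRepellingPeriodicPt f x}.Finite) :
    IntervalDynamics.IsRationalSeries (IntervalDynamics.artinMazurZeta f) ↔
      IntervalDynamics.IsAsymptoticToPeriodicOrbit f c := by
  have : Fact (a ≤ b) := ⟨hab.le⟩
  let _ : Inhabited (Set.Icc a b) := ⟨c⟩
  exact hf.isUnimodalCore.isRationalSeries_artinMazurZeta_iff hrep
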